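/- For a positive integer $n$ let $S_n$ be the group of permutations of $\{1,\dots,n\}$. For a real array $C=(c^{ij}_{kl})_{1\le i,j,k,l\le n}$ let $f:S_n\to\mathbb{R}$ be the objective function of the (generalized) Quadratic Assignment Problem, $$f(\sigma)=\sum_{i,j=1}^n c^{ij}_{\sigma(i)\sigma(j)}$$ (the case $c^{ij}_{kl}=a_{ij}b_{kl}$ is the usual Quadratic Assignment Problem with matrices $A=(a_{ij})$ and $B=(b_{kl})$). Let $\overline f=\frac1{n!}\sum_{\sigma\in S_n}f(\sigma)$, let $f_0=f-\overline f$, and let $\tau\in S_n$ be an optimal permutation, that is, $f_0(\tau)=\max_{\sigma\in S_n}f_0(\sigma)$. Let $\mathbf P$ be the uniform probability on $S_n$. (1) There is an absolute constant $c>0$ such that for every $\alpha>1$ there is an $N(\alpha)$ such that for all $n\ge N(\alpha)$, all arrays $C$ and all optimal $\tau$, $$\mathbf P\Bigl\{\sigma\in S_n:\ f_0(\sigma)\ge\frac{\alpha}{n^2}f_0(\tau)\Bigr\}\ \ge\ \delta n^{-2},\qquad \delta=\exp\{-c\,\alpha\ln\alpha\}.$$ (2) For every $\epsilon>0$ and every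 $\delta>0$ with $\delta>1-\epsilon$ there is an $N(\epsilon,\delta)$ such that for all $n\ge N(\epsilon,\delta)$, all arrays $C$ and all optimal $\tau$, $$\mathbf P\bigl\{\sigma\in S_n:\ f_0(\sigma)\ge n^{-1-\epsilon}f_0(\tau)\bigr\}\ \ge\ \exp\{-n^{\delta}\}.$$ In particular, for every $\epsilon>0$ this holds with some $\delta=\delta(\epsilon)<1$. -/

import Mathlib

noncomputable section

/-- The objective function `f(σ) = ∑_{i,j} c^{ij}_{σ(i)σ(j)}` of the (generalized) quadratic
assignment problem on `S_n`, where `C i j k l` stands for `c^{ij}_{kl}`. The choice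
`C i j k l = a i j * b k l` is the quadratic assignment problem given by two matrices. -/
def qapObjective {n : ℕ} (C : Fin n → Fin n → Fin n → Fin n → ℝ)
    (σ : Equiv.Perm (Fin n)) : ℝ :=
  ∑ i, ∑ j, C i j (σ i) (σ j)

/-- The average value of a real function on `S_n`. -/
def permAverage {n : ℕ} (f : Equiv.Perm (Fin n) → ℝ) : ℝ :=
  (∑ σ, f σ) / (n.factorial : ℝ)

/-- The shifted function `f₀ = f - average of f`. -/
def permShift {n : ℕ} (f : Equiv.Perm (Fin n) → ℝ) (σ : Equiv.Perm (Fin n)) : ℝ :=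
  f σ - permAverage f

/-- The probability that a uniformly random permutation in `S_n` belongs to `E`. -/
def permProb {n : ℕ} (E : Set (Equiv.Perm (Fin n))) : ℝ :=
  (E.ncard : ℝ) / (n.factorial : ℝ)

end

/-!
Normalize to mean zero and maximum `f 1 = 1`. If the set `B = {f ≥ s}` is small, then the `L¹` norm
of `f` is of order `s`, because its positive part is. The average of `f` over the conjugates of a
permutation is an affine combination of `p`, `p (p - 1)` and `q`, where `p` is the number of fixed
points and `q` the number of points on two-cycles. A small `L¹` norm makes the other coefficients
small, and the value `1` at the identity then forces the coefficient of `p (p - 1)` to be about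
`1 / n ^ 2`. So the conjugates of the permutations with `k` fixed points average about
`k ^ 2 / n ^ 2`, which exceeds `s = b / n ^ 2` once `k` is a large multiple of `b`. Since `f ≤ 1`,
a fraction of about `s` of these permutations lies in `B`, and they have density about `1 / k!` in
the symmetric group. With `b = n ^ (1 - ε)` this gives the second part.

In the first part, `exp (-c α log α)` tends to `1` as `α` tends to `1`, so the density of `B` is
needed up to a factor close to `1`. A quadratic function of small `L¹` norm is nearly constant on
most of each coset `{σ | σ i = k ∧ σ j = l}`. Such a coset has density more than `1 / n ^ 2`, so if
`B` has density less than `(1 - η) / n ^ 2`, then the average over every coset is at most a small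
constant, and only boundedly many averages have a large absolute value. Now take permutations with
`k` fixed points and multiply one of them by transpositions that move these points. As `f` is
quadratic, its value is a combination of values at permutations where all but at most one of the
points have been moved and of second differences, which are governed by coset averages. Hence `f`
has a small sum over the conjugates lying in `B`, against the average of order `k ^ 2 / n ^ 2`.
-/

namespace QAP

open Equiv Finset

/-! ### Counting permutations -/

section Counting

lemma factorial_eq_mul_pred_mul {m : ℕ} (hm : 2 ≤ m) :
    m.factorial = m * (m - 1) * (m - 2).factorial := by
  obtain ⟨m, rfl⟩ := Nat.exists_eq_add_of_le' hm
  rw [Nat.factorial_succ, Nat.factorial_succ, ← mul_assoc]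
  rfl

lemma exists_perm_forall_apply_eq {α ι : Type*} [Finite α] {u v : ι → α}
    (huv : ∀ a b, u a = u b ↔ v a = v b) : ∃ π : Perm α, ∀ r, π (u r) = v r := by
  classical
  have := Fintype.ofFinite α
  let e : {x // x ∈ Set.range u} ≃ {x // x ∈ Set.range v} :=
    { toFun x := ⟨v x.2.choose, _, rfl⟩
      invFun y := ⟨u y.2.choose, _, rfl⟩
      left_inv x := by
        refine Subtype.ext (Eq.trans ?_ x.2.choose_spec)
        exact (huv _ _).2 (Exists.choose_spec (⟨_, rfl⟩ : ∃ r, v r = v x.2.choose))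
      right_inv y := by
        refine Subtype.ext (Eq.trans ?_ y.2.choose_spec)
        exact (huv _ _).1 (Exists.choose_spec (⟨_, rfl⟩ : ∃ r, u r = u y.2.choose)) }
  refine ⟨e.extendSubtype, fun r => ?_⟩
  rw [e.extendSubtype_apply_of_mem (u r) ⟨r, rfl⟩]
  exact (huv _ _).1 (Exists.choose_spec (⟨r, rfl⟩ : ∃ s, u s = u r))

variable {α : Type*} [Fintype α] [DecidableEq α]

lemma card_perm_eqOn_range {ι : Type*} [Fintype ι] {u : ι → α} (hu : Function.Injective u)
    (π : Perm α) :
    #{σ : Perm α | ∀ r, σ (u r) = π (u r)} = (Fintype.card α - Fintype.card ι).factorial := by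
  have hfix : #{σ : Perm α | ∀ x, ¬ x ∉ Set.range u → σ x = x} =
      (Fintype.card α - Fintype.card ι).factorial := by
    rw [← Fintype.card_subtype,
      ← Fintype.card_congr (Perm.subtypeEquivSubtypePerm (· ∉ Set.range u)), Fintype.card_perm,
      Fintype.card_subtype_compl]
    congr 2
    exact Set.card_range_of_injective hu
  rw [← hfix]
  refine (card_equiv (Equiv.mulLeft π) fun σ => ?_).symm
  simp

lemma card_perm_forall_apply_eq_le {ι : Type*} [Fintype ι] {u : ι → α}
    (hu : Function.Injective u) (v : ι → α) :
    #{σ : Perm α | ∀ r, σ (u r) = v r} ≤ (Fintype.card α - Fintype.card ι).factorial := by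
  rcases (univ.filter fun σ : Perm α => ∀ r, σ (u r) = v r).eq_empty_or_nonempty with h | ⟨π, hπ⟩
  · simp [h]
  · have hv : ∀ r, v r = π (u r) := fun r => ((mem_filter.1 hπ).2 r).symm
    obtain rfl : v = π ∘ u := funext hv
    exact (card_perm_eqOn_range hu π).le

lemma card_perm_forall_apply_eq {ι : Type*} [Fintype ι] {u v : ι → α}
    (hu : Function.Injective u) (hv : Function.Injective v) :
    #{σ : Perm α | ∀ r, σ (u r) = v r} = (Fintype.card α - Fintype.card ι).factorial := by
  obtain ⟨π, hπ⟩ := exists_perm_forall_apply_eq fun a b => hu.eq_iff.trans hv.eq_iff.symm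
  obtain rfl : π ∘ u = v := funext hπ
  exact card_perm_eqOn_range hu π

lemma card_perm_mapsTo_le (S T : Finset α) :
    #{ω : Perm α | ∀ x ∈ S, ω x ∈ T} ≤
      (#T).descFactorial #S * (Fintype.card α - #S).factorial := by
  calc #{ω : Perm α | ∀ x ∈ S, ω x ∈ T}
      ≤ #(univ.biUnion fun e : S ↪ T => univ.filter fun ω : Perm α => ∀ x : S, ω x = e x) := by
        refine card_le_card fun ω hω => ?_
        simp only [mem_filter, mem_univ, true_and] at hω
        simp only [mem_biUnion, mem_filter, mem_univ, true_and]
        exact ⟨⟨fun x => ⟨ω x, hω x x.2⟩,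
          fun x y h => Subtype.ext (ω.injective (congrArg (·.1) h))⟩, fun x => rfl⟩
    _ ≤ #(univ : Finset (S ↪ T)) * (Fintype.card α - #S).factorial := by
        refine card_biUnion_le_card_mul _ _ _ fun e _ => ?_
        simpa using card_perm_forall_apply_eq_le Subtype.val_injective fun x : S => (e x : α)
    _ = _ := by simp [Fintype.card_embedding_eq]

/-- The permutations with `σ i = k` and `σ j = l`: the cosets over which the objective function
is averaged. -/
def pairCoset (i j k l : α) : Finset (Perm α) := {σ | σ i = k ∧ σ j = l}

@[simp] lemma mem_pairCoset {i j k l : α} {σ : Perm α} :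
    σ ∈ pairCoset i j k l ↔ σ i = k ∧ σ j = l := by simp [pairCoset]

lemma card_pairCoset {i j k l : α} (hij : i ≠ j) (hkl : k ≠ l) :
    #(pairCoset i j k l) = (Fintype.card α - 2).factorial := by
  simpa [Fin.forall_fin_two, pairCoset] using
    card_perm_forall_apply_eq (injective_pair_iff_ne.2 hij) (injective_pair_iff_ne.2 hkl)

/-! ### Fixed points and two-cycles -/

/-- The number of fixed points of `σ`. -/
def fixCard (σ : Perm α) : ℕ := #{x | σ x = x}

/-- The number of points of `σ` on cycles of length two. -/
def twoCycleCard (σ : Perm α) : ℕ := #{x | σ x ≠ x ∧ σ (σ x) = x}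

/-- The permutations whose set of fixed points is exactly `S`. -/
def exactlyFixing (S : Finset α) : Finset (Perm α) := {σ | ∀ x, σ x = x ↔ x ∈ S}

@[simp] lemma mem_exactlyFixing {S : Finset α} {σ : Perm α} :
    σ ∈ exactlyFixing S ↔ ∀ x, σ x = x ↔ x ∈ S := by simp [exactlyFixing]

lemma fixCard_of_mem_exactlyFixing {S : Finset α} {σ : Perm α} (hσ : σ ∈ exactlyFixing S) :
    fixCard σ = #S := by
  simp [fixCard, mem_exactlyFixing.1 hσ]

lemma card_exactlyFixing (S : Finset α) :
    #(exactlyFixing S) = numDerangements (Fintype.card α - #S) := by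
  have h := Fintype.card_congr (derangements.subtypeEquiv (· ∉ S))
  rw [card_derangements_eq_numDerangements] at h
  rw [Fintype.card_subtype_compl, Fintype.card_coe, Fintype.card_subtype] at h
  simpa [exactlyFixing, Function.mem_fixedPoints, Function.IsFixedPt, iff_comm] using h.symm

lemma fixCard_eq_sum (σ : Perm α) : (fixCard σ : ℝ) = ∑ x, if σ x = x then 1 else 0 := by
  simp [fixCard]

lemma fixCard_mul_pred_eq_sum (σ : Perm α) :
    (fixCard σ : ℝ) * (fixCard σ - 1) =
      ∑ z ∈ univ.offDiag, if σ z.1 = z.1 ∧ σ z.2 = z.2 then (1 : ℝ) else 0 := by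
  have h := offDiag_card (univ.filter fun x => σ x = x)
  have hsub : fixCard σ ≤ fixCard σ * fixCard σ := Nat.le_mul_self _
  rw [sum_boole, mul_sub_one, ← Nat.cast_mul, ← Nat.cast_sub hsub, fixCard, ← h]
  congr 2
  ext z
  simp only [mem_offDiag, mem_filter, mem_univ, true_and]
  tauto

lemma twoCycleCard_eq_sum (σ : Perm α) :
    twoCycleCard σ = ∑ z ∈ univ.offDiag, if σ z.1 = z.2 ∧ σ z.2 = z.1 then 1 else 0 := by
  rw [sum_boole, twoCycleCard, Nat.cast_id]
  refine card_bij (fun x _ => (x, σ x)) ?_ ?_ ?_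
  · intro x hx
    simp only [mem_filter, mem_univ, true_and] at hx
    simpa [eq_comm] using hx
  · intro x _ y _ h
    exact congrArg Prod.fst h
  · rintro ⟨x, y⟩ h
    simp only [mem_filter, mem_offDiag, mem_univ, true_and] at h
    obtain ⟨hxy, rfl, hx⟩ := h
    exact ⟨x, by simpa [eq_comm, hx] using hxy, rfl⟩

lemma sum_sum_offDiag_ite_pairCoset {e : α × α → α × α}
    (he : ∀ z : α × α, z.1 ≠ z.2 → (e z).1 ≠ (e z).2) (hα : 2 ≤ Fintype.card α) :
    ∑ σ : Perm α, ∑ z ∈ univ.offDiag,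
      (if σ z.1 = (e z).1 ∧ σ z.2 = (e z).2 then 1 else 0 : ℝ) = (Fintype.card α).factorial := by
  have hcoset : ∀ z ∈ (univ : Finset α).offDiag, ∑ σ : Perm α,
      (if σ z.1 = (e z).1 ∧ σ z.2 = (e z).2 then 1 else 0 : ℝ) =
        (Fintype.card α - 2).factorial := by
    intro z hz
    have hz' : z.1 ≠ z.2 := (mem_offDiag.1 hz).2.2
    rw [sum_boole, ← card_pairCoset hz' (he z hz'), pairCoset]
  rw [sum_comm, sum_congr rfl hcoset, sum_const, offDiag_card, card_univ, nsmul_eq_mul]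
  rw [← Nat.mul_sub_one, factorial_eq_mul_pred_mul hα]
  push_cast
  rfl

lemma sum_fixCard [Nonempty α] : ∑ σ : Perm α, (fixCard σ : ℝ) = (Fintype.card α).factorial := by
  have hpoint : ∀ x : α, ∑ σ : Perm α, (if σ x = x then 1 else 0 : ℝ) =
      (Fintype.card α - 1).factorial := by
    intro x
    rw [sum_boole]
    simpa using card_perm_eqOn_range (Function.injective_of_subsingleton fun _ : Unit => x) 1
  simp only [fixCard_eq_sum]
  rw [sum_comm, sum_congr rfl fun x _ => hpoint x, sum_const, card_univ, nsmul_eq_mul]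
  exact_mod_cast Nat.mul_factorial_pred Fintype.card_ne_zero

lemma sum_fixCard_mul_pred (hα : 2 ≤ Fintype.card α) :
    ∑ σ : Perm α, (fixCard σ : ℝ) * (fixCard σ - 1) = (Fintype.card α).factorial := by
  simp only [fixCard_mul_pred_eq_sum]
  exact sum_sum_offDiag_ite_pairCoset (e := id) (fun _ h => h) hα

lemma sum_twoCycleCard (hα : 2 ≤ Fintype.card α) :
    ∑ σ : Perm α, (twoCycleCard σ : ℝ) = (Fintype.card α).factorial := by
  simp only [twoCycleCard_eq_sum, Nat.cast_sum, Nat.cast_ite, Nat.cast_one, Nat.cast_zero]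
  exact sum_sum_offDiag_ite_pairCoset (e := Prod.swap) (fun _ h => h.symm) hα

lemma mul_swap_mem_exactlyFixing {S : Finset α} {x y : α} (hxy : x ≠ y) (hx : x ∉ S)
    (hy : y ∉ S) {σ : Perm α} :
    σ ∈ exactlyFixing S ∧ σ x = y ∧ σ y = x ↔
      σ * swap x y ∈ exactlyFixing (insert x (insert y S)) := by
  simp only [mem_exactlyFixing, Perm.mul_apply, mem_insert]
  constructor
  · rintro ⟨hS, hσx, hσy⟩ z
    rcases eq_or_ne z x with rfl | hzx
    · simp [hσy]
    rcases eq_or_ne z y with rfl | hzy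
    · simp [hσx]
    simp [swap_apply_of_ne_of_ne hzx hzy, hS, hzx, hzy]
  · intro h
    have hσy : σ y = x := by simpa using h x
    have hσx : σ x = y := by simpa using h y
    refine ⟨fun z => ?_, hσx, hσy⟩
    rcases eq_or_ne z x with rfl | hzx
    · simp [hσx, hxy.symm, hx]
    rcases eq_or_ne z y with rfl | hzy
    · simp [hσy, hxy, hy]
    simpa [swap_apply_of_ne_of_ne hzx hzy, hzx, hzy] using h z

lemma sum_twoCycleCard_exactlyFixing (S : Finset α) :
    ∑ σ ∈ exactlyFixing S, twoCycleCard σ = (Fintype.card α - #S) *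
      (Fintype.card α - #S - 1) * numDerangements (Fintype.card α - #S - 2) := by
  have hcount : ∀ z ∈ (univ : Finset α).offDiag, ∑ σ ∈ exactlyFixing S,
      (if σ z.1 = z.2 ∧ σ z.2 = z.1 then 1 else 0) =
        if z ∈ Sᶜ.offDiag then numDerangements (Fintype.card α - #S - 2) else 0 := by
    rintro ⟨x, y⟩ hz
    have hxy : x ≠ y := (mem_offDiag.1 hz).2.2
    simp only [sum_boole, mem_offDiag, mem_compl, Nat.cast_id]
    split_ifs with h
    · have hcard : #(insert x (insert y S)) = #S + 2 := by
        rw [card_insert_of_notMem (by simp [hxy, h.1]), card_insert_of_notMem h.2.1]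
      rw [Nat.sub_sub, ← hcard, ← card_exactlyFixing]
      refine card_equiv (Equiv.mulRight (swap x y)) fun σ => ?_
      rw [mem_filter, mul_swap_mem_exactlyFixing hxy h.1 h.2.1, Equiv.coe_mulRight]
    · rw [card_eq_zero, filter_eq_empty_iff]
      rintro σ hσ ⟨hσx, hσy⟩
      rw [mem_exactlyFixing] at hσ
      exact h ⟨fun hx => hxy (((hσ x).2 hx).symm.trans hσx),
        fun hy => hxy (hσy.symm.trans ((hσ y).2 hy)), hxy⟩
  simp only [twoCycleCard_eq_sum]
  rw [sum_comm, sum_congr rfl hcount, ← sum_filter, sum_const, smul_eq_mul,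
    filter_mem_eq_inter, inter_eq_right.2 (offDiag_mono (subset_univ _)), offDiag_card, card_compl,
    ← Nat.mul_sub_one]

end Counting

lemma factorial_le_three_mul_numDerangements {m : ℕ} (hm : 2 ≤ m) :
    m.factorial ≤ 3 * numDerangements m := by
  induction m using Nat.strong_induction_on with
  | _ m ih =>
    match m, hm with
    | 2, _ => decide
    | 3, _ => decide
    | m + 4, _ =>
      have h₂ := ih (m + 2) (by omega) (by omega)
      have h₃ := ih (m + 3) (by omega) (by omega)
      rw [numDerangements_add_two, Nat.factorial_succ (m + 3)]
      rw [Nat.factorial_succ (m + 2)] at h₃ ⊢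
      nlinarith

lemma two_mul_numDerangements_le_factorial {m : ℕ} (hm : 1 ≤ m) :
    2 * numDerangements m ≤ m.factorial := by
  induction m using Nat.strong_induction_on with
  | _ m ih =>
    match m, hm with
    | 1, _ => decide
    | 2, _ => decide
    | m + 3, _ =>
      have h₁ := ih (m + 1) (by omega) (by omega)
      have h₂ := ih (m + 2) (by omega) (by omega)
      rw [numDerangements_add_two, Nat.factorial_succ (m + 2)]
      rw [Nat.factorial_succ (m + 1)] at h₂ ⊢
      nlinarith

lemma factorial_le_three_mul_mul_numDerangements {m : ℕ} (hm : 4 ≤ m) :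
    m.factorial ≤ 3 * (m * (m - 1) * numDerangements (m - 2)) := by
  rw [factorial_eq_mul_pred_mul (by omega : 2 ≤ m), mul_left_comm]
  exact Nat.mul_le_mul_left _ (factorial_le_three_mul_numDerangements (by omega))

lemma two_mul_mul_numDerangements_le_factorial {m : ℕ} (hm : 3 ≤ m) :
    2 * (m * (m - 1) * numDerangements (m - 2)) ≤ m.factorial := by
  rw [factorial_eq_mul_pred_mul (by omega : 2 ≤ m), mul_left_comm]
  exact Nat.mul_le_mul_left _ (two_mul_numDerangements_le_factorial (by omega))

/-! ### Averaging over conjugation -/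

section ConjAverage

variable {α : Type*} [Fintype α] [DecidableEq α]

/-- The average of `f` over the conjugates `ω * σ * ω⁻¹` of `σ`. -/
noncomputable def conjAverage (f : Perm α → ℝ) (σ : Perm α) : ℝ :=
  (∑ ω, f (ω * σ * ω⁻¹)) / (Fintype.card α).factorial

lemma sum_conjAverage (f : Perm α → ℝ) : ∑ σ, conjAverage f σ = ∑ σ, f σ := by
  have hconj : ∀ ω : Perm α, ∑ σ, f (ω * σ * ω⁻¹) = ∑ σ, f σ := fun ω =>
    Equiv.sum_comp (MulAut.conj ω).toEquiv f
  simp only [conjAverage, ← sum_div]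
  rw [sum_comm, sum_congr rfl fun ω _ => hconj ω, sum_const, card_univ, Fintype.card_perm,
    nsmul_eq_mul, mul_div_cancel_left₀ _ (Nat.cast_ne_zero.2 (Nat.factorial_ne_zero _))]

lemma conjAverage_one (f : Perm α → ℝ) : conjAverage f 1 = f 1 := by
  simp [conjAverage, Fintype.card_perm, Nat.factorial_ne_zero]

lemma abs_sum_conjAverage_le (f : Perm α → ℝ) (A : Finset (Perm α)) :
    |∑ σ ∈ A, conjAverage f σ| ≤ ∑ σ, |f σ| := by
  have hconj : ∀ ω : Perm α, |∑ σ ∈ A, f (ω * σ * ω⁻¹)| ≤ ∑ σ, |f σ| := by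
    intro ω
    calc |∑ σ ∈ A, f (ω * σ * ω⁻¹)| ≤ ∑ σ ∈ A, |f (ω * σ * ω⁻¹)| := abs_sum_le_sum_abs _ _
      _ ≤ ∑ σ, |f (ω * σ * ω⁻¹)| :=
        sum_le_sum_of_subset_of_nonneg (subset_univ _) fun _ _ _ => abs_nonneg _
      _ = ∑ σ, |f σ| := Equiv.sum_comp (MulAut.conj ω).toEquiv fun σ => |f σ|
  simp only [conjAverage, ← sum_div]
  rw [sum_comm, abs_div, Nat.abs_cast, div_le_iff₀ (by positivity)]
  calc |∑ ω : Perm α, ∑ σ ∈ A, f (ω * σ * ω⁻¹)|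
      ≤ ∑ ω : Perm α, |∑ σ ∈ A, f (ω * σ * ω⁻¹)| := abs_sum_le_sum_abs _ _
    _ ≤ #(univ : Finset (Perm α)) • ∑ σ, |f σ| := sum_le_card_nsmul _ _ _ fun ω _ => hconj ω
    _ = (∑ σ, |f σ|) * (Fintype.card α).factorial := by
      rw [card_univ, Fintype.card_perm, nsmul_eq_mul, mul_comm]

end ConjAverage

lemma sum_offDiag {ι : Type*} [Fintype ι] (F : ι → ι → ℝ) :
    ∑ z ∈ univ.offDiag, F z.1 z.2 = ∑ i, ∑ j, F i j - ∑ i, F i i := by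
  classical
  rw [eq_sub_iff_add_eq', ← sum_diag univ fun z : ι × ι => F z.1 z.2,
    ← sum_union (disjoint_diag_offDiag _), diag_union_offDiag, sum_product]

variable {n : ℕ}

/-- The array `C` averaged over simultaneous relabelling of its four indices. -/
noncomputable def arrayAverage (C : Fin n → Fin n → Fin n → Fin n → ℝ) (i j k l : Fin n) : ℝ :=
  (∑ ω : Perm (Fin n), C (ω i) (ω j) (ω k) (ω l)) / n.factorial

lemma conjAverage_qapObjective (C : Fin n → Fin n → Fin n → Fin n → ℝ) (σ : Perm (Fin n)) :
    conjAverage (qapObjective C) σ = qapObjective (arrayAverage C) σ := by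
  have hrelabel : ∀ ω : Perm (Fin n), qapObjective C (ω * σ * ω⁻¹) =
      ∑ i, ∑ j, C (ω i) (ω j) (ω (σ i)) (ω (σ j)) := by
    intro ω
    rw [qapObjective, ← Equiv.sum_comp ω]
    refine sum_congr rfl fun i _ => ?_
    rw [← Equiv.sum_comp ω]
    simp
  simp only [conjAverage, hrelabel, Fintype.card_fin]
  simp only [qapObjective, arrayAverage, ← sum_div]
  rw [sum_comm]
  exact congrArg (· / _) (sum_congr rfl fun i _ => sum_comm)

lemma arrayAverage_congr (C : Fin n → Fin n → Fin n → Fin n → ℝ) {ι : Type*} {u v : ι → Fin n}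
    (huv : ∀ a b, u a = u b ↔ v a = v b) (a b c d : ι) :
    arrayAverage C (u a) (u b) (u c) (u d) = arrayAverage C (v a) (v b) (v c) (v d) := by
  obtain ⟨π, hπ⟩ := exists_perm_forall_apply_eq huv
  simp only [← hπ, arrayAverage]
  rw [← Equiv.sum_comp (Equiv.mulRight π)]
  simp

lemma exists_arrayAverage_diag (C : Fin n → Fin n → Fin n → Fin n → ℝ) :
    ∃ a₀ a₁ : ℝ, ∀ i k, arrayAverage C i i k k = a₀ + a₁ * if k = i then 1 else 0 := by
  have hfactor : (fun z : Fin n × Fin n => arrayAverage C z.1 z.1 z.2 z.2).FactorsThrough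
      fun z => z.2 = z.1 := by
    rintro ⟨i, k⟩ ⟨i', k'⟩ h
    refine arrayAverage_congr C (u := ![i, k]) (v := ![i', k']) ?_ 0 0 1 1
    simpa [Fin.forall_fin_two, eq_comm] using h
  obtain ⟨φ, hφ⟩ := (Function.factorsThrough_iff _).1 hfactor
  refine ⟨φ False, φ True - φ False, fun i k => ?_⟩
  rw [show arrayAverage C i i k k = φ (k = i) from congrFun hφ (i, k)]
  by_cases h : k = i <;> simp [h]

lemma exists_arrayAverage_offDiag (C : Fin n → Fin n → Fin n → Fin n → ℝ) :
    ∃ b₀ b₁ b₂ b₃ b₄ b₅ b₆ : ℝ, ∀ i j k l, i ≠ j → k ≠ l → arrayAverage C i j k l =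
      b₀ + b₁ * (if k = i then 1 else 0) + b₂ * (if l = j then 1 else 0) +
        b₃ * (if k = i ∧ l = j then 1 else 0) + b₄ * (if k = j then 1 else 0) +
        b₅ * (if l = i then 1 else 0) + b₆ * (if k = j ∧ l = i then 1 else 0) := by
  have hfactor : (fun z : {z : Fin 4 → Fin n // z 0 ≠ z 1 ∧ z 2 ≠ z 3} =>
      arrayAverage C (z.1 0) (z.1 1) (z.1 2) (z.1 3)).FactorsThrough fun z =>
        (z.1 2 = z.1 0, z.1 3 = z.1 1, z.1 2 = z.1 1, z.1 3 = z.1 0) := by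
    rintro ⟨u, hu₁, hu₂⟩ ⟨v, hv₁, hv₂⟩ h
    refine arrayAverage_congr C (u := u) (v := v) ?_ 0 1 2 3
    simp only [Prod.mk.injEq, eq_iff_iff] at h
    obtain ⟨h₁, h₂, h₃, h₄⟩ := h
    intro a b
    fin_cases a <;> fin_cases b <;> simp [hu₁, hu₂, hv₁, hv₂, hu₁.symm, hu₂.symm, hv₁.symm,
      hv₂.symm, h₁, h₂, h₃, h₄, eq_comm (a := u 0), eq_comm (a := u 1), eq_comm (a := v 0),
      eq_comm (a := v 1)]
  obtain ⟨φ, hφ⟩ := (Function.factorsThrough_iff _).1 hfactor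
  let b₀ := φ (False, False, False, False)
  refine ⟨b₀, φ (True, False, False, False) - b₀, φ (False, True, False, False) - b₀,
    φ (True, True, False, False) - φ (True, False, False, False) -
      φ (False, True, False, False) + b₀,
    φ (False, False, True, False) - b₀, φ (False, False, False, True) - b₀,
    φ (False, False, True, True) - φ (False, False, True, False) -
      φ (False, False, False, True) + b₀, fun i j k l hij hkl => ?_⟩
  rw [show arrayAverage C i j k l = φ (k = i, l = j, k = j, l = i) from
    congrFun hφ ⟨![i, j, k, l], hij, hkl⟩]
  by_cases hki : k = i
  · subst hki
    by_cases hlj : l = j <;> simp [hlj, hij, hkl.symm, hij.symm, b₀]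
    ring
  by_cases hlj : l = j
  · subst hlj
    simp [hki, hij.symm, hkl, b₀]
  by_cases hkj : k = j
  · subst hkj
    by_cases hli : l = i <;> simp [hij, hij.symm, hli, hkl.symm, b₀]
    ring
  by_cases hli : l = i
  · subst hli
    simp [hij, hki, hkj, b₀]
  · simp [hki, hlj, hkj, hli, b₀]

lemma exists_conjAverage_form (C : Fin n → Fin n → Fin n → Fin n → ℝ) :
    ∃ x₀ x₁ x₂ x₃ : ℝ, ∀ σ : Perm (Fin n), conjAverage (qapObjective C) σ =
      x₀ + x₁ * fixCard σ + x₂ * (fixCard σ * (fixCard σ - 1)) + x₃ * twoCycleCard σ := by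
  obtain ⟨a₀, a₁, hdiag⟩ := exists_arrayAverage_diag C
  obtain ⟨b₀, b₁, b₂, b₃, b₄, b₅, b₆, hoff⟩ := exists_arrayAverage_offDiag C
  refine ⟨n * a₀ + b₀ * (n * n - n) + (b₄ + b₅) * n,
    a₁ + (b₁ + b₂) * (n - 1) - (b₄ + b₅), b₃, b₆, fun σ => ?_⟩
  have hsplit : conjAverage (qapObjective C) σ = ∑ i, arrayAverage C i i (σ i) (σ i) +
      ∑ z ∈ univ.offDiag, arrayAverage C z.1 z.2 (σ z.1) (σ z.2) := by
    rw [sum_offDiag fun i j => arrayAverage C i j (σ i) (σ j), conjAverage_qapObjective,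
      qapObjective]
    ring
  have hz : ∀ z ∈ (univ : Finset (Fin n)).offDiag, arrayAverage C z.1 z.2 (σ z.1) (σ z.2) = _ :=
    fun z hz => hoff _ _ _ _ (mem_offDiag.1 hz).2.2 (σ.injective.ne (mem_offDiag.1 hz).2.2)
  have h₁ := sum_offDiag fun i _ => if σ i = i then (1 : ℝ) else 0
  have h₂ := sum_offDiag fun _ j => if σ j = j then (1 : ℝ) else 0
  have h₄ := sum_offDiag fun i j => if σ i = j then (1 : ℝ) else 0
  have h₅ := sum_offDiag fun i j => if σ j = i then (1 : ℝ) else 0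
  rw [sum_comm] at h₅
  simp only [sum_const, card_univ, Fintype.card_fin, nsmul_eq_mul, ← mul_sum, sum_ite_eq, mem_univ,
    if_true, mul_one, ← fixCard_eq_sum] at h₁ h₂ h₄ h₅
  have hq : ∑ z ∈ univ.offDiag, (if σ z.1 = z.2 ∧ σ z.2 = z.1 then (1 : ℝ) else 0) =
      twoCycleCard σ := by
    rw [twoCycleCard_eq_sum]
    push_cast
    rfl
  rw [hsplit, sum_congr rfl hz]
  simp only [sum_add_distrib, ← mul_sum, hdiag, h₁, h₂, h₄, h₅, hq, ← fixCard_mul_pred_eq_sum,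
    ← fixCard_eq_sum, sum_const, offDiag_card, card_univ, Fintype.card_fin, nsmul_eq_mul,
    Nat.cast_sub (Nat.le_mul_self n), Nat.cast_mul]
  ring
section ConjForm

variable {α : Type*} [Fintype α] [DecidableEq α]

/-- The conjugation average of `f` is the stated combination of the number of fixed points, its
second factorial power, and the number of points on two-cycles. -/
def HasConjForm (f : Perm α → ℝ) (x₀ x₁ x₂ x₃ : ℝ) : Prop :=
  ∀ σ, conjAverage f σ =
    x₀ + x₁ * fixCard σ + x₂ * (fixCard σ * (fixCard σ - 1)) + x₃ * twoCycleCard σ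

lemma card_exactlyFixing_empty_filter_twoCycleCard (hα : 4 ≤ Fintype.card α) :
    (Fintype.card α).factorial ≤
      12 * #{σ ∈ exactlyFixing (∅ : Finset α) | twoCycleCard σ = 0} := by
  have htwo : ∀ σ : Perm α, twoCycleCard σ ≠ 0 → 2 ≤ twoCycleCard σ := by
    intro σ hσ
    obtain ⟨x, hx⟩ := card_ne_zero.1 hσ
    simp only [mem_filter, mem_univ, true_and] at hx
    refine one_lt_card.2 ⟨x, by simpa using hx, σ x, ?_, hx.1.symm⟩
    simpa [hx.2, eq_comm] using hx.1
  have hcompl : 2 * #{σ ∈ exactlyFixing (∅ : Finset α) | ¬ twoCycleCard σ = 0} ≤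
      ∑ σ ∈ exactlyFixing (∅ : Finset α), twoCycleCard σ := by
    calc 2 * #{σ ∈ exactlyFixing (∅ : Finset α) | ¬ twoCycleCard σ = 0}
        = ∑ σ ∈ exactlyFixing (∅ : Finset α) with ¬ twoCycleCard σ = 0, 2 := by
          rw [sum_const, smul_eq_mul, mul_comm]
      _ ≤ ∑ σ ∈ exactlyFixing (∅ : Finset α) with ¬ twoCycleCard σ = 0, twoCycleCard σ :=
          sum_le_sum fun σ hσ => htwo σ (mem_filter.1 hσ).2
      _ ≤ _ := sum_le_sum_of_subset (filter_subset _ _)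
  have hsplit := card_filter_add_card_filter_not (s := exactlyFixing (∅ : Finset α))
    fun σ => twoCycleCard σ = 0
  rw [sum_twoCycleCard_exactlyFixing, card_empty, Nat.sub_zero] at hcompl
  rw [card_exactlyFixing, card_empty, Nat.sub_zero] at hsplit
  have hD := factorial_le_three_mul_numDerangements (by omega : 2 ≤ Fintype.card α)
  have hE := two_mul_mul_numDerangements_le_factorial (by omega : 3 ≤ Fintype.card α)
  omega

variable {f : Perm α → ℝ} {x₀ x₁ x₂ x₃ : ℝ}

lemma HasConjForm.eq_of_mem_exactlyFixing (hf : HasConjForm f x₀ x₁ x₂ x₃) {S : Finset α}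
    {σ : Perm α} (hσ : σ ∈ exactlyFixing S) :
    conjAverage f σ = x₀ + (x₁ + x₂) * #S + #S * (#S - 2) * x₂ + x₃ * twoCycleCard σ := by
  rw [hf σ, fixCard_of_mem_exactlyFixing hσ]
  ring

lemma HasConjForm.add_eq_zero (hf : HasConjForm f x₀ x₁ x₂ x₃) (h₀ : ∑ σ, f σ = 0)
    (hα : 2 ≤ Fintype.card α) : x₀ + x₁ + x₂ + x₃ = 0 := by
  have : Nonempty α := Fintype.card_pos_iff.1 (by omega)
  have hsum := sum_conjAverage f
  simp only [hf _, sum_add_distrib, ← mul_sum, sum_fixCard, sum_fixCard_mul_pred hα,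
    sum_twoCycleCard hα, sum_const, card_univ, Fintype.card_perm, nsmul_eq_mul, h₀] at hsum
  have hfact : ((Fintype.card α).factorial : ℝ) ≠ 0 := by positivity
  refine (mul_eq_zero_iff_left hfact).1 ?_
  linarith

variable {l : ℝ}

lemma HasConjForm.abs_coef_zero_le (hf : HasConjForm f x₀ x₁ x₂ x₃) (hα : 4 ≤ Fintype.card α)
    (hl : ∑ σ, |f σ| ≤ l * (Fintype.card α).factorial) : |x₀| ≤ 12 * l := by
  set A := {σ ∈ exactlyFixing (∅ : Finset α) | twoCycleCard σ = 0}
  have hA : ((Fintype.card α).factorial : ℝ) ≤ 12 * #A := by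
    exact_mod_cast card_exactlyFixing_empty_filter_twoCycleCard hα
  have hsum : ∑ σ ∈ A, conjAverage f σ = #A * x₀ := by
    rw [← nsmul_eq_mul]
    refine sum_eq_card_nsmul fun σ hσ => ?_
    rw [hf.eq_of_mem_exactlyFixing (mem_filter.1 hσ).1, (mem_filter.1 hσ).2]
    simp
  have hle := (abs_sum_conjAverage_le f A).trans hl
  rw [hsum, abs_mul, Nat.abs_cast] at hle
  have hpos : (0 : ℝ) < (Fintype.card α).factorial := by positivity
  nlinarith [abs_nonneg x₀]

lemma HasConjForm.abs_coef_three_le (hf : HasConjForm f x₀ x₁ x₂ x₃) (hα : 4 ≤ Fintype.card α)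
    (hl : ∑ σ, |f σ| ≤ l * (Fintype.card α).factorial) : |x₃| ≤ 21 * l := by
  set N := Fintype.card α
  have hsum : ∑ σ ∈ exactlyFixing ∅, conjAverage f σ =
      numDerangements N * x₀ + x₃ * (N * (N - 1) * numDerangements (N - 2) : ℕ) := by
    have h := sum_twoCycleCard_exactlyFixing (∅ : Finset α)
    rw [card_empty, Nat.sub_zero] at h
    rw [sum_congr rfl fun σ hσ => hf.eq_of_mem_exactlyFixing hσ, sum_add_distrib, ← mul_sum,
      ← Nat.cast_sum, h]
    simp [card_exactlyFixing, N]
  set E := N * (N - 1) * numDerangements (N - 2)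
  have hD : 2 * (numDerangements N : ℝ) ≤ N.factorial := by
    exact_mod_cast two_mul_numDerangements_le_factorial (by omega : 1 ≤ N)
  have hE : (N.factorial : ℝ) ≤ 3 * E := by
    exact_mod_cast factorial_le_three_mul_mul_numDerangements hα
  have hx₀ := hf.abs_coef_zero_le hα hl
  have hpos : (0 : ℝ) < N.factorial := by positivity
  have hE_le : |x₃| * E ≤ 7 * (l * N.factorial) := by
    calc |x₃| * E = |(numDerangements N * x₀ + x₃ * E) - numDerangements N * x₀| := by
          rw [add_sub_cancel_left, abs_mul, Nat.abs_cast]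
      _ ≤ |numDerangements N * x₀ + x₃ * E| + |numDerangements N * x₀| := abs_sub _ _
      _ ≤ l * N.factorial + numDerangements N * (12 * l) := by
          rw [← hsum, abs_mul, Nat.abs_cast]
          gcongr
          exact (abs_sum_conjAverage_le f _).trans hl
      _ ≤ 7 * (l * N.factorial) := by nlinarith [abs_nonneg x₀]
  nlinarith [abs_nonneg x₃]

lemma HasConjForm.abs_coef_one_add_coef_two_le (hf : HasConjForm f x₀ x₁ x₂ x₃)
    (h₀ : ∑ σ, f σ = 0) (hα : 4 ≤ Fintype.card α)
    (hl : ∑ σ, |f σ| ≤ l * (Fintype.card α).factorial) : |x₁ + x₂| ≤ 33 * l := by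
  have hx₀ := hf.abs_coef_zero_le hα hl
  have hx₃ := hf.abs_coef_three_le hα hl
  have hzero := hf.add_eq_zero h₀ (by omega)
  calc |x₁ + x₂| = |x₀ + x₃| := by rw [← abs_neg]; congr 1; linarith
    _ ≤ |x₀| + |x₃| := abs_add_le _ _
    _ ≤ 33 * l := by linarith

lemma HasConjForm.le_coef_two (hf : HasConjForm f x₀ x₁ x₂ x₃) (h₀ : ∑ σ, f σ = 0)
    (h₁ : f 1 = 1) (hα : 4 ≤ Fintype.card α)
    (hl : ∑ σ, |f σ| ≤ l * (Fintype.card α).factorial)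
    (hsmall : l * (12 + 33 * Fintype.card α) ≤ 1 / 2) :
    1 / (2 * (Fintype.card α : ℝ) ^ 2) ≤ x₂ := by
  set N := Fintype.card α
  have hN : (4 : ℝ) ≤ N := by exact_mod_cast hα
  have hone : (1 : ℝ) = x₀ + (x₁ + x₂) * N + N * (N - 2) * x₂ := by
    have h := hf 1
    rw [conjAverage_one, h₁] at h
    simp only [fixCard, twoCycleCard, Perm.coe_one, id_eq, ne_eq, not_true_eq_false, and_true,
      filter_true, filter_false, card_univ, card_empty, Nat.cast_zero, mul_zero, add_zero] at h
    linarith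
  have hx₀ := le_of_abs_le (hf.abs_coef_zero_le hα hl)
  have hθ := le_of_abs_le (hf.abs_coef_one_add_coef_two_le h₀ hα hl)
  have hhalf : 1 / 2 ≤ N * (N - 2) * x₂ := by nlinarith
  have hx₂ : 0 < x₂ := pos_of_mul_pos_right (by linarith) (by nlinarith : 0 ≤ (N : ℝ) * (N - 2))
  rw [div_le_iff₀ (by positivity)]
  nlinarith

lemma HasConjForm.le_sum_conjAverage (hf : HasConjForm f x₀ x₁ x₂ x₃) (h₀ : ∑ σ, f σ = 0)
    (h₁ : f 1 = 1) (hl : ∑ σ, |f σ| ≤ l * (Fintype.card α).factorial)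
    (hsmall : l * (12 + 33 * Fintype.card α) ≤ 1 / 2) {S : Finset α} (hS : 2 ≤ #S)
    (hSα : #S + 3 ≤ Fintype.card α) {A : Finset (Perm α)} (hA : A ⊆ exactlyFixing S) :
    #A * (#S * (#S - 2) / (2 * (Fintype.card α : ℝ) ^ 2) - (12 + 33 * #S) * l) -
      11 * l * (Fintype.card α - #S).factorial ≤ ∑ σ ∈ A, conjAverage f σ := by
  set N := Fintype.card α
  have hk : (2 : ℝ) ≤ #S := by exact_mod_cast hS
  have hx₀ := neg_le_of_abs_le (hf.abs_coef_zero_le (by omega) hl)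
  have hθ := neg_le_of_abs_le (hf.abs_coef_one_add_coef_two_le h₀ (by omega) hl)
  have hx₂ := hf.le_coef_two h₀ h₁ (by omega) hl hsmall
  have hx₃ := neg_le_of_abs_le (hf.abs_coef_three_le (by omega) hl)
  have hl₀ : 0 ≤ l := by linarith [abs_nonneg x₀, hf.abs_coef_zero_le (by omega) hl]
  have htc : ∑ σ ∈ A, (twoCycleCard σ : ℝ) ≤ (N - #S).factorial / 2 := by
    have hE := (sum_le_sum_of_subset hA).trans (sum_twoCycleCard_exactlyFixing S).le
    have hE' := two_mul_mul_numDerangements_le_factorial (by omega : 3 ≤ N - #S)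
    rw [le_div_iff₀' two_pos]
    exact_mod_cast (Nat.mul_le_mul_left 2 hE).trans hE'
  have hconst : #S * (#S - 2) / (2 * (N : ℝ) ^ 2) - (12 + 33 * #S) * l ≤
      x₀ + (x₁ + x₂) * #S + #S * (#S - 2) * x₂ := by
    have := mul_le_mul_of_nonneg_left hx₂ (by nlinarith : (0 : ℝ) ≤ #S * (#S - 2))
    rw [mul_one_div] at this
    nlinarith
  have htc₀ : 0 ≤ ∑ σ ∈ A, (twoCycleCard σ : ℝ) := by positivity
  calc _ ≤ #A * (x₀ + (x₁ + x₂) * #S + #S * (#S - 2) * x₂) +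
        x₃ * ∑ σ ∈ A, (twoCycleCard σ : ℝ) := by
        have := mul_le_mul_of_nonneg_left hconst (Nat.cast_nonneg #A)
        nlinarith
    _ = _ := by
        rw [sum_congr rfl fun σ hσ => hf.eq_of_mem_exactlyFixing (hA hσ), sum_add_distrib, mul_sum,
          sum_const, nsmul_eq_mul]

end ConjForm
section ConjPairs

variable {α : Type*} [Fintype α] [DecidableEq α]

/-- The pairs `(ω, π)` with `π ∈ A` for which the conjugate `ω * π * ω⁻¹` lies in `B`. -/
def conjPairs (A B : Finset (Perm α)) : Finset (Perm α × Perm α) :=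
  {z ∈ univ ×ˢ A | z.1 * z.2 * z.1⁻¹ ∈ B}

@[simp] lemma mem_conjPairs {A B : Finset (Perm α)} {z : Perm α × Perm α} :
    z ∈ conjPairs A B ↔ z.2 ∈ A ∧ z.1 * z.2 * z.1⁻¹ ∈ B := by simp [conjPairs]

lemma fixCard_conj (ω σ : Perm α) : fixCard (ω * σ * ω⁻¹) = fixCard σ := by
  rw [fixCard, fixCard, ← card_image_of_injective {x | σ x = x} ω.injective]
  congr 1
  ext y
  obtain ⟨x, rfl⟩ := ω.surjective y
  simp only [mem_filter, mem_univ, true_and, ω.injective.mem_finset_image]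
  simp

lemma card_conjPairs_le {S : Finset α} {A : Finset (Perm α)} (hA : A ⊆ exactlyFixing S)
    (B : Finset (Perm α)) :
    #(conjPairs A B) ≤ (#S).factorial * (Fintype.card α - #S).factorial * #B := by
  refine card_le_mul_card_image_of_maps_to (f := fun z => z.1 * z.2 * z.1⁻¹)
    (fun z hz => (mem_conjPairs.1 hz).2) _ fun β _ => ?_
  let fiber := {z ∈ conjPairs A B | z.1 * z.2 * z.1⁻¹ = β}
  have hmaps : ∀ z ∈ fiber, ∀ x, β (z.1 x) = z.1 x ↔ x ∈ S := by
    intro z hz x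
    obtain ⟨hzAB, rfl⟩ := mem_filter.1 hz
    simp [← mem_exactlyFixing.1 (hA (mem_conjPairs.1 hzAB).1) x]
  obtain hempty | ⟨z₀, hz₀⟩ := fiber.eq_empty_or_nonempty
  · simp [fiber, hempty]
  have hfix : #{x | β x = x} = #S := by
    obtain ⟨hzAB, rfl⟩ := mem_filter.1 hz₀
    exact (fixCard_conj _ _).trans (fixCard_of_mem_exactlyFixing (hA (mem_conjPairs.1 hzAB).1))
  calc #fiber ≤ #{ω : Perm α | ∀ x ∈ S, ω x ∈ ({x | β x = x} : Finset α)} := by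
        refine card_le_card_of_injOn Prod.fst (fun z hz => ?_) fun z hz w hw hzw => ?_
        · simpa using fun x hx => (hmaps z hz x).2 hx
        · have h := (mem_filter.1 hz).2.trans (mem_filter.1 hw).2.symm
          rw [hzw] at h
          exact Prod.ext hzw (mul_left_cancel (mul_right_cancel h))
    _ ≤ _ := by simpa [hfix, Nat.descFactorial_self] using card_perm_mapsTo_le S {x | β x = x}

lemma sum_conjAverage_le (f : Perm α → ℝ) {s : ℝ} (hs : 0 ≤ s) (A : Finset (Perm α)) :
    (Fintype.card α).factorial * ∑ σ ∈ A, conjAverage f σ ≤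
      (Fintype.card α).factorial * #A * s +
        ∑ z ∈ conjPairs A {σ | s ≤ f σ}, f (z.1 * z.2 * z.1⁻¹) := by
  have hterm : ∀ z ∈ univ ×ˢ A, f (z.1 * z.2 * z.1⁻¹) ≤
      s + if z.1 * z.2 * z.1⁻¹ ∈ univ.filter (s ≤ f ·) then f (z.1 * z.2 * z.1⁻¹) else 0 := by
    intro z _
    split_ifs with h <;> simp only [mem_filter, mem_univ, true_and, not_le] at h <;> linarith
  have hfact : ((Fintype.card α).factorial : ℝ) ≠ 0 := by positivity
  calc _ = ∑ z ∈ univ ×ˢ A, f (z.1 * z.2 * z.1⁻¹) := by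
        rw [sum_product_right, mul_sum]
        refine sum_congr rfl fun σ _ => mul_div_cancel₀ _ hfact
    _ ≤ _ := sum_le_sum hterm
    _ = _ := by
        rw [sum_add_distrib, sum_const, card_product, card_univ, Fintype.card_perm, nsmul_eq_mul,
          ← sum_filter, conjPairs]
        push_cast
        rfl

lemma sum_abs_le_of_le_one {ι : Type*} [Fintype ι] {f : ι → ℝ} (h₀ : ∑ i, f i = 0)
    (h₁ : ∀ i, f i ≤ 1) {s : ℝ} (hs : 0 ≤ s) :
    ∑ i, |f i| ≤ 2 * (s * Fintype.card ι + #{i | s ≤ f i}) := by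
  have hterm : ∀ i, |f i| ≤ 2 * (s + if s ≤ f i then 1 else 0) - f i := by
    intro i
    split_ifs with hi
    · rw [abs_of_nonneg (hs.trans hi)]
      linarith [h₁ i]
    · rw [abs_le]
      constructor <;> linarith
  refine (sum_le_sum fun i _ => hterm i).trans (le_of_eq ?_)
  rw [sum_sub_distrib, h₀, ← mul_sum, sum_add_distrib, sum_boole, sum_const, card_univ,
    nsmul_eq_mul]
  ring

variable {f : Perm α → ℝ} {x₀ x₁ x₂ x₃ : ℝ}

lemma HasConjForm.card_mul_le_sum_conjPairs (hf : HasConjForm f x₀ x₁ x₂ x₃) (h₀ : ∑ σ, f σ = 0)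
    (h₁ : f 1 = 1) {l s : ℝ} (hl : ∑ σ, |f σ| ≤ l * (Fintype.card α).factorial)
    (hsmall : l * (12 + 33 * Fintype.card α) ≤ 1 / 2) (hs : 0 ≤ s) {S : Finset α} (hS : 2 ≤ #S)
    (hSα : #S + 3 ≤ Fintype.card α) {A : Finset (Perm α)} (hA : A ⊆ exactlyFixing S)
    (hcard : (Fintype.card α - #S).factorial ≤ 4 * #A) :
    #A * (Fintype.card α).factorial *
      (#S * (#S - 2) / (2 * (Fintype.card α : ℝ) ^ 2) - (56 + 33 * #S) * l - s) ≤
      ∑ z ∈ conjPairs A {σ | s ≤ f σ}, f (z.1 * z.2 * z.1⁻¹) := by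
  have hlower := hf.le_sum_conjAverage h₀ h₁ hl hsmall hS hSα hA
  have hupper := sum_conjAverage_le f hs A
  have hl₀ : 0 ≤ l := nonneg_of_mul_nonneg_left
    ((sum_nonneg fun σ _ => abs_nonneg (f σ)).trans hl) (by positivity)
  have herror : l * (Fintype.card α - #S).factorial ≤ l * (4 * #A) := by
    gcongr
    exact_mod_cast hcard
  have hlower' : #A * (#S * (#S - 2) / (2 * (Fintype.card α : ℝ) ^ 2) - (56 + 33 * #S) * l) ≤
      ∑ σ ∈ A, conjAverage f σ := by linarith
  have hscaled := mul_le_mul_of_nonneg_left hlower' (Nat.cast_nonneg (Fintype.card α).factorial)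
  linarith

lemma HasConjForm.le_card_mul (hf : HasConjForm f x₀ x₁ x₂ x₃) (h₀ : ∑ σ, f σ = 0) (h₁ : f 1 = 1)
    (hmax : ∀ σ, f σ ≤ 1) {s : ℝ} (hs : 0 ≤ s)
    (hsmall : 4 * s * (12 + 33 * Fintype.card α) ≤ 1 / 2)
    (hB : (#{σ | s ≤ f σ} : ℝ) ≤ s * (Fintype.card α).factorial)
    {k : ℕ} (hk : 2 ≤ k) (hkα : k + 3 ≤ Fintype.card α) :
    (k * (k - 2) / (2 * (Fintype.card α : ℝ) ^ 2) - (225 + 132 * k) * s) *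
      (Fintype.card α).factorial ≤ 3 * k.factorial * #{σ | s ≤ f σ} := by
  set B : Finset (Perm α) := {σ | s ≤ f σ}
  obtain ⟨S, -, rfl⟩ := exists_subset_card_eq (s := (univ : Finset α)) (n := k)
    (by rw [card_univ]; omega)
  have hl : ∑ σ, |f σ| ≤ 4 * s * (Fintype.card α).factorial := by
    have := sum_abs_le_of_le_one h₀ hmax hs
    rw [Fintype.card_perm] at this
    linarith
  have hE : (Fintype.card α - #S).factorial ≤ 3 * #(exactlyFixing S) := by
    rw [card_exactlyFixing]
    exact factorial_le_three_mul_numDerangements (by omega)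
  have hE₀ : (0 : ℝ) < #(exactlyFixing S) := by
    exact_mod_cast pos_of_mul_pos_right ((Nat.factorial_pos _).trans_le hE) (Nat.zero_le _)
  have hpairs : ∑ z ∈ conjPairs (exactlyFixing S) B, f (z.1 * z.2 * z.1⁻¹) ≤
      (#S).factorial * (3 * #(exactlyFixing S)) * #B := by
    calc _ ≤ #(conjPairs (exactlyFixing S) B) • (1 : ℝ) := sum_le_card_nsmul _ _ _ fun z _ => hmax _
      _ ≤ ((#S).factorial * (Fintype.card α - #S).factorial * #B : ℕ) := by
        rw [nsmul_one]
        exact_mod_cast card_conjPairs_le (subset_refl (exactlyFixing S)) B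
      _ ≤ _ := by exact_mod_cast Nat.mul_le_mul_right _ (Nat.mul_le_mul_left _ hE)
  have hlower := hf.card_mul_le_sum_conjPairs h₀ h₁ hl hsmall hs hk hkα
    (subset_refl (exactlyFixing S)) (by omega)
  refine le_of_mul_le_mul_left ?_ hE₀
  linarith

end ConjPairs
/-! ### Second differences of quadratic functions -/

section SecondDifference

variable {α : Type*} [DecidableEq α]

/-- The rank-one matrix `(e_i - e_a) ⊗ (e_k - e_l)`: multiplying `σ` by the transposition of `i`
and `a` subtracts `rect i a (σ i) (σ a)` from the permutation matrix of `σ`. -/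
def rect (i a k l : α) : Matrix α α ℝ :=
  Matrix.vecMulVec (Pi.single i 1 - Pi.single a 1) (Pi.single k 1 - Pi.single l 1)

lemma rect_eq_sub_sub_add (i a k l x w : α) :
    rect i a k l = rect i x k w - rect i x l w - rect a x k w + rect a x l w := by
  simp only [rect, Matrix.vecMulVec_sub, Matrix.sub_vecMulVec]
  abel

lemma permMatrix_mul_swap (σ : Perm α) {i a : α} (hia : i ≠ a) :
    (σ * swap i a).permMatrix ℝ = σ.permMatrix ℝ - rect i a (σ i) (σ a) := by
  ext x y
  rcases eq_or_ne x i with rfl | hxi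
  · simp [rect, Matrix.vecMulVec_apply, PEquiv.toMatrix_apply, Pi.single_apply, hia, eq_comm]
  rcases eq_or_ne x a with rfl | hxa
  · simp [rect, Matrix.vecMulVec_apply, PEquiv.toMatrix_apply, Pi.single_apply, hia.symm, eq_comm]
  · simp [rect, Matrix.vecMulVec_apply, PEquiv.toMatrix_apply, swap_apply_of_ne_of_ne hxi hxa,
      hxi, hxa]

/-- A function on permutations is quadratic if it is a quadratic form in the entries of the
permutation matrix. -/
def IsQuadratic (f : Perm α → ℝ) : Prop :=
  ∃ B : Matrix α α ℝ →ₗ[ℝ] Matrix α α ℝ →ₗ[ℝ] ℝ,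
    ∀ σ : Perm α, f σ = B (σ.permMatrix ℝ) (σ.permMatrix ℝ)

lemma isQuadratic_qapObjective {n : ℕ} (C : Fin n → Fin n → Fin n → Fin n → ℝ) :
    IsQuadratic (qapObjective C) := by
  refine ⟨LinearMap.mk₂ ℝ (fun M P => ∑ i, ∑ j, ∑ k, ∑ l, C i j k l * M i k * P j l)
    ?_ ?_ ?_ ?_, fun σ => ?_⟩
  · intro M M' P
    simp only [Matrix.add_apply, mul_add, add_mul, sum_add_distrib]
  · intro c M P
    simp only [Matrix.smul_apply, smul_eq_mul, Finset.mul_sum, mul_left_comm, mul_assoc]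
  · intro M P P'
    simp only [Matrix.add_apply, mul_add, sum_add_distrib]
  · intro c M P
    simp only [Matrix.smul_apply, smul_eq_mul, Finset.mul_sum, mul_left_comm, mul_assoc]
  · simp [qapObjective, PEquiv.toMatrix_apply]

/-- The second difference of `f` at `σ` along the transpositions `(i a)` and `(j b)`. -/
def secDiff (f : Perm α → ℝ) (σ : Perm α) (i a j b : α) : ℝ :=
  f σ - f (σ * swap i a) - f (σ * swap j b) + f (σ * swap i a * swap j b)

lemma secDiff_eq {f : Perm α → ℝ} {B : Matrix α α ℝ →ₗ[ℝ] Matrix α α ℝ →ₗ[ℝ] ℝ}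
    (hB : ∀ σ : Perm α, f σ = B (σ.permMatrix ℝ) (σ.permMatrix ℝ)) (σ : Perm α) {i a j b : α}
    (hd : [i, a, j, b].Nodup) :
    secDiff f σ i a j b = (B + B.flip) (rect i a (σ i) (σ a)) (rect j b (σ j) (σ b)) := by
  simp only [List.nodup_cons, List.mem_cons, List.not_mem_nil, or_false, not_or] at hd
  obtain ⟨⟨hia, hij, hib⟩, ⟨haj, hab⟩, hjb, -⟩ := hd
  have hσj : (σ * swap i a) j = σ j := by
    rw [Perm.mul_apply, swap_apply_of_ne_of_ne (Ne.symm hij) (Ne.symm haj)]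
  have hσb : (σ * swap i a) b = σ b := by
    rw [Perm.mul_apply, swap_apply_of_ne_of_ne (Ne.symm hib) (Ne.symm hab)]
  rw [secDiff, hB, hB, hB, hB, permMatrix_mul_swap (σ * swap i a) hjb, permMatrix_mul_swap σ hia,
    permMatrix_mul_swap σ hjb, hσj, hσb]
  simp only [map_sub, LinearMap.sub_apply, LinearMap.add_apply, LinearMap.flip_apply]
  ring

lemma IsQuadratic.exists_secDiff_eq {f : Perm α → ℝ} (hf : IsQuadratic f) :
    ∃ B : Matrix α α ℝ →ₗ[ℝ] Matrix α α ℝ →ₗ[ℝ] ℝ, ∀ (σ : Perm α) (i a j b : α),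
      [i, a, j, b].Nodup →
        secDiff f σ i a j b = B (rect i a (σ i) (σ a)) (rect j b (σ j) (σ b)) := by
  obtain ⟨B, hB⟩ := hf
  exact ⟨B + B.flip, fun σ _ _ _ _ => secDiff_eq hB σ⟩

lemma IsQuadratic.secDiff_congr {f : Perm α → ℝ} (hf : IsQuadratic f) {σ τ : Perm α} {i a j b : α}
    (hd : [i, a, j, b].Nodup) (hi : σ i = τ i) (ha : σ a = τ a) (hj : σ j = τ j) (hb : σ b = τ b) :
    secDiff f σ i a j b = secDiff f τ i a j b := by
  obtain ⟨B, hB⟩ := hf.exists_secDiff_eq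
  rw [hB σ i a j b hd, hB τ i a j b hd, hi, ha, hj, hb]

end SecondDifference

/-! ### Quadratic functions are nearly constant on cosets -/

section Concentration

variable {α : Type*} [Fintype α] [DecidableEq α]

lemma sum_pairCoset_mul_right (F : Perm α → ℝ) (t : Perm α) (i j k l : α) :
    ∑ σ ∈ pairCoset i j k l, F (σ * t) = ∑ σ ∈ pairCoset (t⁻¹ i) (t⁻¹ j) k l, F σ :=
  sum_equiv (Equiv.mulRight t) (fun σ => by simp) fun _ _ => rfl

lemma sum_sum_pairCoset (F : Perm α → ℝ) (k l : α) :
    ∑ x, ∑ y, ∑ σ ∈ pairCoset x y k l, F σ = ∑ σ, F σ := by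
  have hfilter : ∀ p : α × α, pairCoset p.1 p.2 k l =
      univ.filter fun σ : Perm α => (σ⁻¹ k, σ⁻¹ l) = p := by
    intro p
    ext σ
    simp only [mem_pairCoset, mem_filter, mem_univ, true_and, Prod.ext_iff, Perm.inv_eq_iff_eq]
    exact and_congr eq_comm eq_comm
  rw [← Fintype.sum_prod_type' fun x y => ∑ σ ∈ pairCoset x y k l, F σ]
  simp only [hfilter]
  exact sum_fiberwise _ _ _

/-- The mass of `|f|` on the cosets obtained from `pairCoset i j k l` by replacing `i` by `x`, `j`
by `y`, or both. -/
noncomputable def adjMass (f : Perm α → ℝ) (i j k l x y : α) : ℝ :=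
  ∑ σ ∈ pairCoset x j k l, |f σ| + ∑ σ ∈ pairCoset i y k l, |f σ| +
    ∑ σ ∈ pairCoset x y k l, |f σ|

lemma adjMass_nonneg (f : Perm α → ℝ) (i j k l x y : α) : 0 ≤ adjMass f i j k l x y := by
  unfold adjMass
  positivity

lemma sum_adjMass_le [Nonempty α] (f : Perm α → ℝ) (i j k l : α) :
    ∑ x, ∑ y, adjMass f i j k l x y ≤ 3 * Fintype.card α * ∑ σ, |f σ| := by
  have hrow : ∑ x, ∑ σ ∈ pairCoset x j k l, |f σ| ≤ ∑ σ, |f σ| := by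
    rw [← sum_sum_pairCoset (fun σ => |f σ|) k l]
    exact sum_le_sum fun x _ => single_le_sum (f := fun y => ∑ σ ∈ pairCoset x y k l, |f σ|)
      (fun y _ => by positivity) (mem_univ j)
  have hcol : ∑ y, ∑ σ ∈ pairCoset i y k l, |f σ| ≤ ∑ σ, |f σ| := by
    rw [← sum_sum_pairCoset (fun σ => |f σ|) k l]
    exact single_le_sum (f := fun x => ∑ y, ∑ σ ∈ pairCoset x y k l, |f σ|)
      (fun x _ => by positivity) (mem_univ i)
  have hboth := (sum_sum_pairCoset (fun σ => |f σ|) k l).le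
  have hcard : (1 : ℝ) ≤ Fintype.card α := by exact_mod_cast Fintype.card_pos
  have hmass : 0 ≤ ∑ σ, |f σ| := by positivity
  simp only [adjMass, sum_add_distrib, sum_const, card_univ, nsmul_eq_mul, ← mul_sum]
  nlinarith

lemma sum_abs_sub_secDiff_le (f : Perm α → ℝ) {i x j y : α} (k l : α)
    (hd : [i, x, j, y].Nodup) :
    ∑ σ ∈ pairCoset i j k l, |f σ - secDiff f σ i x j y| ≤ adjMass f i j k l x y := by
  simp only [List.nodup_cons, List.mem_cons, List.not_mem_nil, or_false, not_or] at hd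
  obtain ⟨⟨-, hij, hiy⟩, ⟨hxj, hxy⟩, -⟩ := hd
  have hx := sum_pairCoset_mul_right (fun σ => |f σ|) (swap i x) i j k l
  have hy := sum_pairCoset_mul_right (fun σ => |f σ|) (swap j y) i j k l
  have hboth := sum_pairCoset_mul_right (fun σ => |f σ|) (swap i x * swap j y) i j k l
  simp only [mul_inv_rev, swap_inv, Perm.mul_apply, swap_apply_left,
    swap_apply_of_ne_of_ne (Ne.symm hij) (Ne.symm hxj), swap_apply_of_ne_of_ne hij hiy,
    swap_apply_of_ne_of_ne hxj hxy] at hx hy hboth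
  rw [adjMass, ← hx, ← hy, ← hboth, ← sum_add_distrib, ← sum_add_distrib]
  refine sum_le_sum fun σ _ => ?_
  calc |f σ - secDiff f σ i x j y|
      = |f (σ * swap i x) + f (σ * swap j y) - f (σ * (swap i x * swap j y))| := by
        rw [secDiff, mul_assoc]; ring_nf
    _ ≤ |f (σ * swap i x)| + |f (σ * swap j y)| + |f (σ * (swap i x * swap j y))| :=
        (abs_sub _ _).trans (add_le_add_left (abs_add_le _ _) _)

lemma sq_card_le_two_mul_card_offDiag_compl {Z : Finset α} (hZ : #Z ≤ 6)
    (hα : 50 ≤ Fintype.card α) : (Fintype.card α : ℝ) ^ 2 ≤ 2 * #Zᶜ.offDiag := by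
  obtain ⟨m, hm⟩ : ∃ m, #Zᶜ = m + 1 := Nat.exists_eq_add_of_le' (by rw [card_compl]; omega)
  have hle : (Fintype.card α : ℝ) ≤ m + 7 := by
    have := card_compl Z
    exact_mod_cast (by omega : Fintype.card α ≤ m + 7)
  have hge : (43 : ℝ) ≤ m := by
    have := card_compl Z
    exact_mod_cast (by omega : 43 ≤ m)
  rw [offDiag_card, hm, ← Nat.mul_sub_one, Nat.add_sub_cancel]
  push_cast
  nlinarith

lemma exists_adjMass_le (hα : 50 ≤ Fintype.card α) (f : Perm α → ℝ) (i j k l : α) {Z : Finset α}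
    (hZ : #Z ≤ 6) : ∃ x y, x ∉ Z ∧ y ∉ Z ∧ x ≠ y ∧
      adjMass f i j k l x y ≤ 6 * (∑ σ, |f σ|) / Fintype.card α := by
  have : Nonempty α := Fintype.card_pos_iff.1 (by omega)
  have hpos : (0 : ℝ) < Fintype.card α := by exact_mod_cast Fintype.card_pos
  have hcard := sq_card_le_two_mul_card_offDiag_compl hZ hα
  have hne : Zᶜ.offDiag.Nonempty := by
    rw [← card_pos]
    exact_mod_cast (by nlinarith : (0 : ℝ) < #Zᶜ.offDiag)
  obtain ⟨p, hp, hle⟩ := exists_le_of_sum_le (f := fun p : α × α => adjMass f i j k l p.1 p.2)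
    (g := fun _ => 6 * (∑ σ, |f σ|) / Fintype.card α) hne (by
      calc ∑ p ∈ Zᶜ.offDiag, adjMass f i j k l p.1 p.2
          ≤ ∑ p : α × α, adjMass f i j k l p.1 p.2 :=
            sum_le_sum_of_subset_of_nonneg (subset_univ _) fun _ _ _ => adjMass_nonneg _ _ _ _ _ _ _
        _ ≤ 3 * Fintype.card α * ∑ σ, |f σ| := by
            rw [Fintype.sum_prod_type' fun x y => adjMass f i j k l x y]
            exact sum_adjMass_le f i j k l
        _ ≤ 2 * #Zᶜ.offDiag * (3 * (∑ σ, |f σ|) / Fintype.card α) := by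
            calc 3 * Fintype.card α * ∑ σ, |f σ|
                = (Fintype.card α : ℝ) ^ 2 * (3 * (∑ σ, |f σ|) / Fintype.card α) := by
                  field_simp
              _ ≤ _ := by gcongr
        _ = ∑ p ∈ Zᶜ.offDiag, 6 * (∑ σ, |f σ|) / Fintype.card α := by
            rw [sum_const, nsmul_eq_mul]; ring)
  simp only [mem_offDiag, mem_compl] at hp
  exact ⟨p.1, p.2, hp.1, hp.2.1, hp.2.2, hle⟩

lemma IsQuadratic.sum_abs_sub_mul_le_adjMass {f : Perm α → ℝ} (hf : IsQuadratic f) {i x j y : α}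
    (k l : α) (hd : [i, x, j, y].Nodup) {ω : Perm α}
    (hi : ω i = i) (hx : ω x = x) (hj : ω j = j) (hy : ω y = y) :
    ∑ σ ∈ pairCoset i j k l, |f σ - f (σ * ω)| ≤ 2 * adjMass f i j k l x y := by
  have hσ := sum_abs_sub_secDiff_le f k l hd
  have hσω : ∑ σ ∈ pairCoset i j k l, |f (σ * ω) - secDiff f (σ * ω) i x j y| ≤
      adjMass f i j k l x y := by
    rw [sum_pairCoset_mul_right (fun σ => |f σ - secDiff f σ i x j y|) ω i j k l,
      Perm.inv_eq_iff_eq.2 hi.symm, Perm.inv_eq_iff_eq.2 hj.symm]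
    exact hσ
  have hsec : ∀ σ, secDiff f (σ * ω) i x j y = secDiff f σ i x j y := fun σ =>
    hf.secDiff_congr hd (by rw [Perm.mul_apply, hi]) (by rw [Perm.mul_apply, hx])
      (by rw [Perm.mul_apply, hj]) (by rw [Perm.mul_apply, hy])
  simp only [hsec] at hσω
  calc ∑ σ ∈ pairCoset i j k l, |f σ - f (σ * ω)|
      ≤ ∑ σ ∈ pairCoset i j k l, (|f σ - secDiff f σ i x j y| +
          |f (σ * ω) - secDiff f σ i x j y|) := sum_le_sum fun σ _ => by
        rw [abs_sub_comm (f (σ * ω))]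
        exact abs_sub_le _ _ _
    _ ≤ 2 * adjMass f i j k l x y := by rw [sum_add_distrib]; linarith

omit [Fintype α] in
/-- The reference points of `sum_abs_sub_mul_le_adjMass` must be fixed by `ω`; a general `ω` is the
product of two permutations fixing two reference points each. -/
lemma exists_mul_eq_of_apply_eq [Finite α] {ω : Perm α} {i j x y x' y' : α}
    (hi : ω i = i) (hj : ω j = j)
    (hx : x ∉ ({i, j} : Finset α)) (hy : y ∉ ({i, j} : Finset α))
    (hx' : x' ∉ ({i, j, x, y, ω⁻¹ x, ω⁻¹ y} : Finset α))
    (hy' : y' ∉ ({i, j, x, y, ω⁻¹ x, ω⁻¹ y} : Finset α)) :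
    ∃ g h : Perm α, g * h = ω ∧ (g i = i ∧ g x = x ∧ g j = j ∧ g y = y) ∧
      h i = i ∧ h x' = x' ∧ h j = j ∧ h y' = y' := by
  have hinv : ω⁻¹ i = i ∧ ω⁻¹ j = j := ⟨Perm.inv_eq_iff_eq.2 hi.symm, Perm.inv_eq_iff_eq.2 hj.symm⟩
  have hne : ∀ z ∉ ({i, j} : Finset α), ω⁻¹ z ∉ ({i, j} : Finset α) := by
    intro z hz
    simpa only [mem_insert, mem_singleton, Perm.inv_eq_iff_eq, hi, hj] using hz
  have hx₁ := hne x hx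
  have hy₁ := hne y hy
  simp only [mem_insert, mem_singleton, not_or] at hx hy hx' hy' hx₁ hy₁
  obtain ⟨h, hh⟩ := exists_perm_forall_apply_eq (u := ![i, j, x', y', ω⁻¹ x, ω⁻¹ y])
    (v := ![i, j, x', y', x, y]) (by
      have hxy : ω⁻¹ x = ω⁻¹ y ↔ x = y := ω⁻¹.injective.eq_iff
      generalize ω⁻¹ x = x₁ at *
      generalize ω⁻¹ y = y₁ at *
      simp only [Fin.forall_fin_succ, IsEmpty.forall_iff, Matrix.cons_val_zero,
        Matrix.cons_val_succ]
      grind)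
  simp only [Fin.forall_fin_succ, IsEmpty.forall_iff, Matrix.cons_val_zero,
    Matrix.cons_val_succ] at hh
  obtain ⟨h_i, h_j, hhx', hhy', hhx, hhy, -⟩ := hh
  refine ⟨ω * h⁻¹, h, by group, ⟨?_, ?_, ?_, ?_⟩, h_i, hhx', h_j, hhy'⟩
  · rw [Perm.mul_apply, Perm.inv_eq_iff_eq.2 h_i.symm, hi]
  · rw [Perm.mul_apply, Perm.inv_eq_iff_eq.2 hhx.symm]; simp
  · rw [Perm.mul_apply, Perm.inv_eq_iff_eq.2 h_j.symm, hj]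
  · rw [Perm.mul_apply, Perm.inv_eq_iff_eq.2 hhy.symm]; simp

lemma IsQuadratic.sum_abs_sub_mul_le {f : Perm α → ℝ} (hf : IsQuadratic f)
    (hα : 50 ≤ Fintype.card α) {i j : α} (k l : α) (hij : i ≠ j) {ω : Perm α} (hi : ω i = i)
    (hj : ω j = j) :
    ∑ σ ∈ pairCoset i j k l, |f σ - f (σ * ω)| ≤ 24 * (∑ σ, |f σ|) / Fintype.card α := by
  obtain ⟨x, y, hx, hy, hxy, hle⟩ :=
    exists_adjMass_le hα f i j k l (Z := {i, j}) (card_le_two.trans (by norm_num))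
  obtain ⟨x', y', hx', hy', hxy', hle'⟩ :=
    exists_adjMass_le hα f i j k l (Z := {i, j, x, y, ω⁻¹ x, ω⁻¹ y}) card_le_six
  obtain ⟨g, h, rfl, ⟨hgi, hgx, hgj, hgy⟩, h_i, hhx', h_j, hhy'⟩ :=
    exists_mul_eq_of_apply_eq hi hj hx hy hx' hy'
  simp only [mem_insert, mem_singleton, not_or] at hx hy hx' hy'
  have hg := hf.sum_abs_sub_mul_le_adjMass k l (i := i) (x := x) (j := j) (y := y)
    (by grind) hgi hgx hgj hgy
  have hh : ∑ σ ∈ pairCoset i j k l, |f (σ * g) - f (σ * g * h)| ≤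
      2 * adjMass f i j k l x' y' := by
    rw [sum_pairCoset_mul_right (fun σ => |f σ - f (σ * h)|) g i j k l,
      Perm.inv_eq_iff_eq.2 hgi.symm, Perm.inv_eq_iff_eq.2 hgj.symm]
    exact hf.sum_abs_sub_mul_le_adjMass k l (by grind) h_i hhx' h_j hhy'
  calc ∑ σ ∈ pairCoset i j k l, |f σ - f (σ * (g * h))|
      ≤ ∑ σ ∈ pairCoset i j k l, (|f σ - f (σ * g)| + |f (σ * g) - f (σ * g * h)|) :=
        sum_le_sum fun σ _ => by rw [← mul_assoc]; exact abs_sub_le _ _ _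
    _ ≤ 2 * adjMass f i j k l x y + 2 * adjMass f i j k l x' y' := by
        rw [sum_add_distrib]; exact add_le_add hg hh
    _ ≤ 2 * (6 * (∑ σ, |f σ|) / Fintype.card α) + 2 * (6 * (∑ σ, |f σ|) / Fintype.card α) := by
        gcongr
    _ = 24 * (∑ σ, |f σ|) / Fintype.card α := by ring

/-- The average of `f` over `pairCoset i j k l`, where `q = (i, j, k, l)`, `i ≠ j` and `k ≠ l`. -/
noncomputable def cosetAverage (f : Perm α → ℝ) (q : α × α × α × α) : ℝ :=
  (∑ σ ∈ pairCoset q.1 q.2.1 q.2.2.1 q.2.2.2, f σ) / (Fintype.card α - 2).factorial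

lemma mul_abs_sub_cosetAverage_le (f : Perm α → ℝ) {i j k l : α} (hij : i ≠ j)
    (hkl : k ≠ l) {σ : Perm α} (hσ : σ ∈ pairCoset i j k l) :
    (Fintype.card α - 2).factorial * |f σ - cosetAverage f (i, j, k, l)| ≤
      ∑ ω ∈ pairCoset i j i j, |f σ - f (σ * ω)| := by
  have hreindex : ∑ ω ∈ pairCoset i j i j, (f σ - f (σ * ω)) =
      ∑ τ ∈ pairCoset i j k l, (f σ - f τ) := by
    rw [mem_pairCoset] at hσ
    refine sum_equiv (Equiv.mulLeft σ) (fun ω => ?_) fun _ _ => rfl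
    simp [← hσ.1, ← hσ.2]
  have hpos : (0 : ℝ) < (Fintype.card α - 2).factorial := by positivity
  calc (Fintype.card α - 2).factorial * |f σ - cosetAverage f (i, j, k, l)|
      = |∑ τ ∈ pairCoset i j k l, (f σ - f τ)| := by
        rw [sum_sub_distrib, sum_const, nsmul_eq_mul, card_pairCoset hij hkl, cosetAverage,
          ← abs_of_pos hpos, ← abs_mul, abs_of_pos hpos, mul_sub, mul_div_cancel₀ _ hpos.ne']
    _ ≤ ∑ ω ∈ pairCoset i j i j, |f σ - f (σ * ω)| := by
        rw [← hreindex]; exact abs_sum_le_sum_abs _ _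

theorem IsQuadratic.sum_abs_sub_cosetAverage_le {f : Perm α → ℝ} (hf : IsQuadratic f)
    (hα : 50 ≤ Fintype.card α) {i j k l : α} (hij : i ≠ j) (hkl : k ≠ l) :
    ∑ σ ∈ pairCoset i j k l, |f σ - cosetAverage f (i, j, k, l)| ≤
      24 * (∑ σ, |f σ|) / Fintype.card α := by
  refine le_of_mul_le_mul_left (a := ((Fintype.card α - 2).factorial : ℝ)) ?_ (by positivity)
  calc (Fintype.card α - 2).factorial * ∑ σ ∈ pairCoset i j k l, |f σ - cosetAverage f (i, j, k, l)|
      ≤ ∑ σ ∈ pairCoset i j k l, ∑ ω ∈ pairCoset i j i j, |f σ - f (σ * ω)| := by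
        rw [mul_sum]
        exact sum_le_sum fun σ hσ => mul_abs_sub_cosetAverage_le f hij hkl hσ
    _ = ∑ ω ∈ pairCoset i j i j, ∑ σ ∈ pairCoset i j k l, |f σ - f (σ * ω)| := sum_comm
    _ ≤ ∑ ω ∈ pairCoset i j i j, 24 * (∑ σ, |f σ|) / Fintype.card α :=
        sum_le_sum fun ω hω => hf.sum_abs_sub_mul_le hα k l hij (mem_pairCoset.1 hω).1
          (mem_pairCoset.1 hω).2
    _ = _ := by rw [sum_const, card_pairCoset hij hij, nsmul_eq_mul]

end Concentration
section Corners

variable {α : Type*}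

/-- The index quadruples `(i', j', k', l')` of the sixteen cosets with `i' ∈ {i, a}`,
`j' ∈ {j, b}`, `k' ∈ {σ i, σ a}`, `l' ∈ {σ j, σ b}`, on which a second difference at `σ` depends. -/
def corner (σ : Perm α) (i a j b : α) : Bool × Bool × Bool × Bool → α × α × α × α
  | (p, q, r, s) => (cond p a i, cond q b j, cond r (σ a) (σ i), cond s (σ b) (σ j))

/-- The sign with which the average over a coset enters a second difference. -/
def cornerSign : Bool × Bool × Bool × Bool → ℝ
  | (p, q, r, s) => cond p (-1) 1 * cond q (-1) 1 * cond r (-1) 1 * cond s (-1) 1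

lemma abs_cornerSign (p : Bool × Bool × Bool × Bool) : |cornerSign p| = 1 := by
  obtain ⟨p, q, r, s⟩ := p
  cases p <;> cases q <;> cases r <;> cases s <;> simp [cornerSign]

lemma corner_ne (σ : Perm α) {i a j b : α} (hd : [i, a, j, b].Nodup)
    (p : Bool × Bool × Bool × Bool) :
    (corner σ i a j b p).1 ≠ (corner σ i a j b p).2.1 ∧
      (corner σ i a j b p).2.2.1 ≠ (corner σ i a j b p).2.2.2 := by
  obtain ⟨p, q, r, s⟩ := p
  simp only [List.nodup_cons, List.mem_cons, List.not_mem_nil, or_false, not_or] at hd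
  obtain ⟨⟨hia, hij, hib⟩, ⟨haj, hab⟩, hjb, -⟩ := hd
  cases p <;> cases q <;> cases r <;> cases s <;> simp [corner, *]

variable [DecidableEq α]

lemma bilin_rect_eq_sum_corner (B : Matrix α α ℝ →ₗ[ℝ] Matrix α α ℝ →ₗ[ℝ] ℝ) (σ : Perm α)
    (i a j b x y w v : α) :
    B (rect i a (σ i) (σ a)) (rect j b (σ j) (σ b)) =
      ∑ p, cornerSign p * B (rect (corner σ i a j b p).1 x (corner σ i a j b p).2.2.1 w)
        (rect (corner σ i a j b p).2.1 y (corner σ i a j b p).2.2.2 v) := by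
  rw [rect_eq_sub_sub_add i a (σ i) (σ a) x w, rect_eq_sub_sub_add j b (σ j) (σ b) y v]
  simp only [map_sub, map_add, LinearMap.sub_apply, LinearMap.add_apply, Fintype.sum_prod_type,
    Fintype.sum_bool, corner, cornerSign, cond_true, cond_false]
  ring

lemma corner_mem (σ : Perm α) (i a j b : α) (c : Bool × Bool × Bool × Bool) :
    ((corner σ i a j b c).1 ∈ ({i, a, j, b} : Finset α) ∧
        (corner σ i a j b c).2.1 ∈ ({i, a, j, b} : Finset α)) ∧
      (corner σ i a j b c).2.2.1 ∈ ({σ i, σ a, σ j, σ b} : Finset α) ∧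
        (corner σ i a j b c).2.2.2 ∈ ({σ i, σ a, σ j, σ b} : Finset α) := by
  obtain ⟨p, q, r, s⟩ := c
  cases p <;> cases q <;> cases r <;> cases s <;> simp [corner]

variable [Fintype α]

lemma factorial_mul_sum_offDiag_le_sum_pairCoset {i j x y k l : α} {Z : Finset α}
    (hd : [i, x, j, y].Nodup) (hkl : k ≠ l) (hk : k ∈ Z) (hl : l ∈ Z) {G : α → α → ℝ}
    (hG : ∀ w v, 0 ≤ G w v) :
    (Fintype.card α - 4).factorial * ∑ p ∈ Zᶜ.offDiag, G p.1 p.2 ≤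
      ∑ σ ∈ pairCoset i j k l, G (σ x) (σ y) := by
  have hfiber : ∀ p ∈ Zᶜ.offDiag,
      #{σ ∈ pairCoset i j k l | (σ x, σ y) = p} = (Fintype.card α - 4).factorial := by
    rintro ⟨w, v⟩ hp
    simp only [mem_offDiag, mem_compl] at hp
    have hu : Function.Injective ![i, x, j, y] := by
      rw [← List.nodup_ofFn]
      simpa using hd
    have hv : Function.Injective ![k, w, l, v] := by
      have hvals : [k, w, l, v].Nodup := by grind
      rw [← List.nodup_ofFn]
      simpa using hvals
    rw [← Fintype.card_fin 4, ← card_perm_forall_apply_eq hu hv]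
    congr 1
    ext σ
    simp only [mem_filter, mem_pairCoset, Prod.mk.injEq, mem_univ, true_and, Fin.forall_fin_succ,
      IsEmpty.forall_iff, Matrix.cons_val_zero, Matrix.cons_val_succ, and_true]
    tauto
  calc (Fintype.card α - 4).factorial * ∑ p ∈ Zᶜ.offDiag, G p.1 p.2
      = ∑ p ∈ Zᶜ.offDiag, ∑ σ ∈ pairCoset i j k l with (σ x, σ y) = p, G (σ x) (σ y) := by
        rw [mul_sum]
        refine sum_congr rfl fun p hp => ?_
        rw [← hfiber p hp, ← nsmul_eq_mul, ← sum_const]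
        refine sum_congr rfl fun σ hσ => ?_
        rw [← (mem_filter.1 hσ).2]
    _ ≤ ∑ σ ∈ pairCoset i j k l, G (σ x) (σ y) :=
        sum_fiberwise_le_sum_of_sum_fiber_nonneg fun p _ => sum_nonneg fun _ _ => hG _ _

/-- Averaged over the auxiliary rows `x, y`, the second difference along `(i x)` and `(j y)` is
close to the average of `f` on `pairCoset i j k l`, since the other three cosets involved carry
little mass. -/
lemma IsQuadratic.sum_sum_abs_secDiff_sub_cosetAverage_le {f : Perm α → ℝ} (hf : IsQuadratic f)
    (hα : 50 ≤ Fintype.card α) {i j k l : α} (hij : i ≠ j) (hkl : k ≠ l) {Z : Finset α}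
    (hi : i ∈ Z) (hj : j ∈ Z) :
    ∑ p ∈ Zᶜ.offDiag, ∑ σ ∈ pairCoset i j k l,
      |secDiff f σ i p.1 j p.2 - cosetAverage f (i, j, k, l)| ≤
        27 * Fintype.card α * ∑ σ, |f σ| := by
  have : Nonempty α := ⟨i⟩
  have hpos : (0 : ℝ) < Fintype.card α := by exact_mod_cast Fintype.card_pos
  have hadj : ∀ p ∈ Zᶜ.offDiag, ∑ σ ∈ pairCoset i j k l,
      |secDiff f σ i p.1 j p.2 - cosetAverage f (i, j, k, l)| ≤
        adjMass f i j k l p.1 p.2 + 24 * (∑ σ, |f σ|) / Fintype.card α := by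
    rintro ⟨x, y⟩ hp
    simp only [mem_offDiag, mem_compl] at hp
    refine le_trans ?_ (add_le_add (sum_abs_sub_secDiff_le f (x := x) (y := y) k l (by grind))
      (hf.sum_abs_sub_cosetAverage_le hα hij hkl))
    rw [← sum_add_distrib]
    refine sum_le_sum fun σ _ => ?_
    rw [abs_sub_comm (f σ)]
    exact abs_sub_le _ _ _
  calc _ ≤ ∑ p ∈ Zᶜ.offDiag, (adjMass f i j k l p.1 p.2 +
        24 * (∑ σ, |f σ|) / Fintype.card α) := sum_le_sum hadj
    _ ≤ ∑ p : α × α, (adjMass f i j k l p.1 p.2 + 24 * (∑ σ, |f σ|) / Fintype.card α) :=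
        sum_le_sum_of_subset_of_nonneg (subset_univ _) fun p _ _ =>
          add_nonneg (adjMass_nonneg _ _ _ _ _ _ _) (by positivity)
    _ ≤ 3 * Fintype.card α * (∑ σ, |f σ|) + Fintype.card α ^ 2 *
          (24 * (∑ σ, |f σ|) / Fintype.card α) := by
        rw [sum_add_distrib, Fintype.sum_prod_type' fun x y => adjMass f i j k l x y, sum_const,
          card_univ, Fintype.card_prod, nsmul_eq_mul, Nat.cast_mul, ← sq]
        gcongr
        exact sum_adjMass_le f i j k l
    _ = 27 * Fintype.card α * ∑ σ, |f σ| := by field_simp; ring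

lemma IsQuadratic.factorial_mul_sum_sum_abs_sub_cosetAverage_le {f : Perm α → ℝ}
    (hf : IsQuadratic f) (hα : 50 ≤ Fintype.card α)
    {B : Matrix α α ℝ →ₗ[ℝ] Matrix α α ℝ →ₗ[ℝ] ℝ}
    (hB : ∀ (σ : Perm α) (i a j b : α), [i, a, j, b].Nodup →
      secDiff f σ i a j b = B (rect i a (σ i) (σ a)) (rect j b (σ j) (σ b)))
    {i j k l : α} (hij : i ≠ j) (hkl : k ≠ l) {Z Z' : Finset α} (hi : i ∈ Z) (hj : j ∈ Z)
    (hk : k ∈ Z') (hl : l ∈ Z') :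
    (Fintype.card α - 4).factorial * ∑ p ∈ Zᶜ.offDiag, ∑ q ∈ Z'ᶜ.offDiag,
      |B (rect i p.1 k q.1) (rect j p.2 l q.2) - cosetAverage f (i, j, k, l)| ≤
        27 * Fintype.card α * ∑ σ, |f σ| := by
  refine le_trans ?_ (hf.sum_sum_abs_secDiff_sub_cosetAverage_le hα hij hkl hi hj)
  rw [mul_sum]
  refine sum_le_sum fun p hp => ?_
  simp only [mem_offDiag, mem_compl] at hp
  have hd : [i, p.1, j, p.2].Nodup := by grind
  refine (factorial_mul_sum_offDiag_le_sum_pairCoset hd hkl hk hl (G := fun w v =>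
    |B (rect i p.1 k w) (rect j p.2 l v) - cosetAverage f (i, j, k, l)|)
    fun _ _ => abs_nonneg _).trans (sum_le_sum fun τ hτ => ?_)
  rw [hB τ i p.1 j p.2 hd, (mem_pairCoset.1 hτ).1, (mem_pairCoset.1 hτ).2]

/-- Splitting both rectangles at auxiliary points `x, w` and `y, v`, and averaging over these,
writes a second difference as a signed sum of sixteen terms, each close to a coset average. -/
lemma IsQuadratic.factorial_mul_card_mul_abs_secDiff_sub_le {f : Perm α → ℝ} (hf : IsQuadratic f)
    (hα : 50 ≤ Fintype.card α) (σ : Perm α) {i a j b : α} (hd : [i, a, j, b].Nodup)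
    {Z Z' : Finset α} (hZ : Z = {i, a, j, b}) (hZ' : Z' = {σ i, σ a, σ j, σ b}) :
    (Fintype.card α - 4).factorial * (#Zᶜ.offDiag * #Z'ᶜ.offDiag *
      |secDiff f σ i a j b - ∑ c, cornerSign c * cosetAverage f (corner σ i a j b c)|) ≤
        432 * Fintype.card α * ∑ σ, |f σ| := by
  obtain ⟨B, hB⟩ := hf.exists_secDiff_eq
  set D := secDiff f σ i a j b - ∑ c, cornerSign c * cosetAverage f (corner σ i a j b c) with hD
  set G : Bool × Bool × Bool × Bool → α × α → α × α → ℝ := fun c p q =>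
    |B (rect (corner σ i a j b c).1 p.1 (corner σ i a j b c).2.2.1 q.1)
      (rect (corner σ i a j b c).2.1 p.2 (corner σ i a j b c).2.2.2 q.2) -
        cosetAverage f (corner σ i a j b c)|
  have hpointwise : ∀ p q : α × α, |D| ≤ ∑ c, G c p q := by
    intro p q
    rw [hD, hB σ i a j b hd, bilin_rect_eq_sum_corner B σ i a j b p.1 p.2 q.1 q.2,
      ← sum_sub_distrib]
    refine (abs_sum_le_sum_abs _ _).trans (sum_le_sum fun c _ => ?_)
    rw [← mul_sub, abs_mul, abs_cornerSign, one_mul]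
  calc (Fintype.card α - 4).factorial * (#Zᶜ.offDiag * #Z'ᶜ.offDiag * |D|)
      = (Fintype.card α - 4).factorial * ∑ _ ∈ Zᶜ.offDiag, ∑ _ ∈ Z'ᶜ.offDiag, |D| := by
        simp only [sum_const, nsmul_eq_mul, mul_assoc]
    _ ≤ (Fintype.card α - 4).factorial * ∑ p ∈ Zᶜ.offDiag, ∑ q ∈ Z'ᶜ.offDiag, ∑ c, G c p q := by
        gcongr
        exact hpointwise _ _
    _ = ∑ c, (Fintype.card α - 4).factorial * ∑ p ∈ Zᶜ.offDiag, ∑ q ∈ Z'ᶜ.offDiag, G c p q := by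
        rw [← mul_sum, sum_congr rfl fun p _ => sum_comm, sum_comm]
    _ ≤ ∑ c : Bool × Bool × Bool × Bool, 27 * Fintype.card α * ∑ σ, |f σ| := by
        refine sum_le_sum fun c _ => ?_
        obtain ⟨hrow, hcol⟩ := corner_mem σ i a j b c
        rw [← hZ] at hrow
        rw [← hZ'] at hcol
        exact hf.factorial_mul_sum_sum_abs_sub_cosetAverage_le hα hB (corner_ne σ hd c).1
          (corner_ne σ hd c).2 hrow.1 hrow.2 hcol.1 hcol.2
    _ = 432 * Fintype.card α * ∑ σ, |f σ| := by
        simp only [sum_const, card_univ, Fintype.card_prod, Fintype.card_bool, nsmul_eq_mul]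
        push_cast
        ring

theorem IsQuadratic.abs_secDiff_sub_le {f : Perm α → ℝ} (hf : IsQuadratic f)
    (hα : 50 ≤ Fintype.card α) (σ : Perm α) {i a j b : α} (hd : [i, a, j, b].Nodup) :
    |secDiff f σ i a j b - ∑ c, cornerSign c * cosetAverage f (corner σ i a j b c)| ≤
      1728 * (∑ σ, |f σ|) / (Fintype.card α * (Fintype.card α - 2).factorial) := by
  have hsum := hf.factorial_mul_card_mul_abs_secDiff_sub_le hα σ hd rfl rfl
  set N := Fintype.card α
  set D := secDiff f σ i a j b - ∑ c, cornerSign c * cosetAverage f (corner σ i a j b c)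
  set Z : Finset α := {i, a, j, b}
  set Z' : Finset α := {σ i, σ a, σ j, σ b}
  have hN : (50 : ℝ) ≤ N := by exact_mod_cast hα
  have hZ := sq_card_le_two_mul_card_offDiag_compl (Z := Z) (card_le_four.trans (by norm_num)) hα
  have hZ' := sq_card_le_two_mul_card_offDiag_compl (Z := Z') (card_le_four.trans (by norm_num)) hα
  have hchoices : (N : ℝ) ^ 4 ≤ 4 * (#Zᶜ.offDiag * #Z'ᶜ.offDiag) := by nlinarith
  have hfact : ((N - 2).factorial : ℝ) ≤ N ^ 2 * (N - 4).factorial := by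
    rw [← Nat.factorial_mul_descFactorial (show 2 ≤ N - 2 by omega), mul_comm (_ ^ 2),
      Nat.sub_sub]
    norm_cast
    gcongr
    exact (Nat.descFactorial_le_pow _ _).trans (Nat.pow_le_pow_left (Nat.sub_le _ _) _)
  rw [le_div_iff₀ (by positivity)]
  refine le_of_mul_le_mul_left (a := (N : ℝ)) ?_ (by linarith)
  calc (N : ℝ) * (|D| * (N * (N - 2).factorial))
      ≤ N * (|D| * (N * (N ^ 2 * (N - 4).factorial))) := by gcongr
    _ = (N - 4).factorial * (N ^ 4 * |D|) := by ring
    _ ≤ (N - 4).factorial * (4 * (#Zᶜ.offDiag * #Z'ᶜ.offDiag) * |D|) := by gcongr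
    _ ≤ N * (1728 * ∑ σ, |f σ|) := by linarith

end Corners
/-! ### Cosets with a large average -/

section LargeCosets

variable {α : Type*} [Fintype α] [DecidableEq α]

lemma abs_cosetAverage_le (f : Perm α → ℝ) (q : α × α × α × α) :
    |cosetAverage f q| ≤ (∑ σ, |f σ|) / (Fintype.card α - 2).factorial := by
  rw [cosetAverage, abs_div, Nat.abs_cast]
  gcongr
  exact (abs_sum_le_sum_abs _ _).trans
    (sum_le_sum_of_subset_of_nonneg (subset_univ _) fun _ _ _ => abs_nonneg _)

lemma IsQuadratic.sub_le_card_abs_sub_cosetAverage_lt {f : Perm α → ℝ} (hf : IsQuadratic f)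
    (hα : 50 ≤ Fintype.card α) {i j k l : α} (hij : i ≠ j) (hkl : k ≠ l) {c : ℝ} (hc : 0 < c) :
    (Fintype.card α - 2).factorial - 24 * (∑ σ, |f σ|) / (Fintype.card α * c) ≤
      #{σ ∈ pairCoset i j k l | |f σ - cosetAverage f (i, j, k, l)| < c} := by
  set far := {σ ∈ pairCoset i j k l | ¬|f σ - cosetAverage f (i, j, k, l)| < c}
  have hmarkov : #far * c ≤ 24 * (∑ σ, |f σ|) / Fintype.card α := by
    calc #far * c ≤ ∑ σ ∈ far, |f σ - cosetAverage f (i, j, k, l)| := by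
          rw [← nsmul_eq_mul]
          exact card_nsmul_le_sum _ _ _ fun σ hσ => not_lt.1 (mem_filter.1 hσ).2
      _ ≤ ∑ σ ∈ pairCoset i j k l, |f σ - cosetAverage f (i, j, k, l)| :=
          sum_le_sum_of_subset_of_nonneg (filter_subset _ _) fun _ _ _ => abs_nonneg _
      _ ≤ _ := hf.sum_abs_sub_cosetAverage_le hα hij hkl
  have hsplit := card_filter_add_card_filter_not (s := pairCoset i j k l)
    (fun σ => |f σ - cosetAverage f (i, j, k, l)| < c)
  rw [card_pairCoset hij hkl] at hsplit
  rw [← hsplit, ← div_div]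
  push_cast
  linarith [(le_div_iff₀ hc).2 hmarkov]

lemma IsQuadratic.sub_le_card_of_le_cosetAverage {f : Perm α → ℝ} (hf : IsQuadratic f)
    (hα : 50 ≤ Fintype.card α) {i j k l : α} (hij : i ≠ j) (hkl : k ≠ l) {c s : ℝ} (hc : 0 < c)
    (hle : c + s ≤ cosetAverage f (i, j, k, l)) :
    (Fintype.card α - 2).factorial - 24 * (∑ σ, |f σ|) / (Fintype.card α * c) ≤
      #{σ | s ≤ f σ} := by
  refine (hf.sub_le_card_abs_sub_cosetAverage_lt hα hij hkl hc).trans ?_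
  gcongr
  intro σ hσ
  simp only [mem_filter, mem_univ, true_and] at hσ ⊢
  linarith [(abs_lt.1 hσ.2).1]

lemma card_inter_pairCoset_le {i j k l i' j' k' l' : α} (hij : i ≠ j) (hij' : i' ≠ j')
    (hne : (i', j', k', l') ≠ (i, j, k, l)) (hne' : (i', j', k', l') ≠ (j, i, l, k)) :
    #(pairCoset i j k l ∩ pairCoset i' j' k' l') ≤ (Fintype.card α - 3).factorial := by
  have htriple : ∀ x y : α, x ≠ i → x ≠ j →
      #{σ : Perm α | σ i = k ∧ σ j = l ∧ σ x = y} ≤ (Fintype.card α - 3).factorial := by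
    intro x y hxi hxj
    have hu : Function.Injective ![i, j, x] := by
      rw [← List.nodup_ofFn]
      simpa using ⟨⟨hij, hxi.symm⟩, hxj.symm⟩
    simpa [Fin.forall_fin_succ] using card_perm_forall_apply_eq_le hu ![k, l, y]
  by_cases hi : i' = i ∨ i' = j
  · by_cases hj : j' = i ∨ j' = j
    · suffices pairCoset i j k l ∩ pairCoset i' j' k' l' = ∅ by simp [this]
      refine eq_empty_of_forall_notMem fun σ hσ => ?_
      simp only [mem_inter, mem_pairCoset] at hσ
      grind
    · push Not at hj
      refine (card_le_card fun σ hσ => ?_).trans (htriple j' l' hj.1 hj.2)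
      simp only [mem_inter, mem_pairCoset] at hσ
      simp [hσ]
  · push Not at hi
    refine (card_le_card fun σ hσ => ?_).trans (htriple i' k' hi.1 hi.2)
    simp only [mem_inter, mem_pairCoset] at hσ
    simp [hσ]

open Classical in
/-- The index quadruples of the cosets on which the average of `f` is at least `c` in absolute
value. -/
noncomputable def largeCosets (f : Perm α → ℝ) (c : ℝ) : Finset (α × α × α × α) :=
  {q | q.1 ≠ q.2.1 ∧ q.2.2.1 ≠ q.2.2.2 ∧ c ≤ |cosetAverage f q|}

lemma mem_largeCosets {f : Perm α → ℝ} {c : ℝ} {q : α × α × α × α} :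
    q ∈ largeCosets f c ↔ q.1 ≠ q.2.1 ∧ q.2.2.1 ≠ q.2.2.2 ∧ c ≤ |cosetAverage f q| := by
  simp [largeCosets]

lemma IsQuadratic.sub_le_card_of_mem_largeCosets {f : Perm α → ℝ} (hf : IsQuadratic f)
    (hα : 50 ≤ Fintype.card α) {c : ℝ} (hc : 0 < c) {q : α × α × α × α}
    (hq : q ∈ largeCosets f c) :
    (Fintype.card α - 2).factorial - 48 * (∑ σ, |f σ|) / (Fintype.card α * c) ≤
      #{σ ∈ pairCoset q.1 q.2.1 q.2.2.1 q.2.2.2 | c / 2 ≤ |f σ|} := by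
  obtain ⟨hij, hkl, hle⟩ := mem_largeCosets.1 hq
  have hclose := hf.sub_le_card_abs_sub_cosetAverage_lt hα hij hkl (half_pos hc)
  have hconst : 24 * (∑ σ, |f σ|) / (Fintype.card α * (c / 2)) =
      48 * (∑ σ, |f σ|) / (Fintype.card α * c) := by
    field_simp
    ring
  rw [hconst] at hclose
  refine hclose.trans ?_
  gcongr with σ
  intro hlt
  have := abs_sub_abs_le_abs_sub (cosetAverage f q) (f σ)
  rw [abs_sub_comm] at this
  linarith

/-- Two cosets have a small intersection unless they are equal, and the coset of `(i, j, k, l)` is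
only equal to that of `(j, i, l, k)`: a permutation lies in at most two cosets, apart from those
sharing few elements. -/
lemma sum_card_pairCoset_inter_le {Q : Finset (α × α × α × α)} (hQ : ∀ q ∈ Q, q.1 ≠ q.2.1)
    (G : Finset (Perm α)) :
    ∑ q ∈ Q, #(G ∩ pairCoset q.1 q.2.1 q.2.2.1 q.2.2.2) ≤
      2 * #G + #Q ^ 2 * (Fintype.card α - 3).factorial := by
  let coset (q : α × α × α × α) := pairCoset q.1 q.2.1 q.2.2.1 q.2.2.2
  let P := {p ∈ Q ×ˢ Q | p.2 ≠ p.1 ∧ p.2 ≠ (p.1.2.1, p.1.1, p.1.2.2.2, p.1.2.2.1)}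
  have hpoint : ∀ σ ∈ G, #{q ∈ Q | σ ∈ coset q} ≤
      2 + #{p ∈ P | σ ∈ coset p.1 ∩ coset p.2} := by
    intro σ _
    obtain hempty | ⟨q, hq⟩ := ({q ∈ Q | σ ∈ coset q} : Finset _).eq_empty_or_nonempty
    · simp [hempty]
    have hsplit := le_card_sdiff {q, (q.2.1, q.1, q.2.2.2, q.2.2.1)} {q ∈ Q | σ ∈ coset q}
    have hpair : #({q ∈ Q | σ ∈ coset q} \ {q, (q.2.1, q.1, q.2.2.2, q.2.2.1)}) ≤
        #{p ∈ P | σ ∈ coset p.1 ∩ coset p.2} := by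
      refine card_le_card_of_injOn (fun q' => (q, q')) (fun q' hq' => ?_) fun _ _ _ _ h =>
        congrArg Prod.snd h
      simp only [coe_sdiff, coe_filter, Set.mem_sdiff, Set.mem_ofPred_eq, coe_insert, coe_singleton,
        Set.mem_insert_iff, Set.mem_singleton_iff, not_or, mem_filter] at hq hq'
      simp [P, hq, hq']
    have := card_le_two (a := q) (b := (q.2.1, q.1, q.2.2.2, q.2.2.1))
    omega
  calc ∑ q ∈ Q, #(G ∩ coset q) = ∑ σ ∈ G, #{q ∈ Q | σ ∈ coset q} := by
        simp only [← filter_mem_eq_inter]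
        exact (sum_card_bipartiteAbove_eq_sum_card_bipartiteBelow _).symm
    _ ≤ ∑ σ ∈ G, (2 + #{p ∈ P | σ ∈ coset p.1 ∩ coset p.2}) := sum_le_sum hpoint
    _ = 2 * #G + ∑ p ∈ P, #{σ ∈ G | σ ∈ coset p.1 ∩ coset p.2} := by
        rw [sum_add_distrib, sum_const, smul_eq_mul, mul_comm]
        exact congrArg _ (sum_card_bipartiteAbove_eq_sum_card_bipartiteBelow _)
    _ ≤ 2 * #G + #P * (Fintype.card α - 3).factorial := by
        gcongr
        refine sum_le_card_nsmul _ _ _ fun p hp => ?_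
        simp only [P, mem_filter, mem_product] at hp
        refine (card_le_card fun σ hσ => (mem_filter.1 hσ).2).trans ?_
        exact card_inter_pairCoset_le (hQ _ hp.1.1) (hQ _ hp.1.2) hp.2.1 hp.2.2
    _ ≤ 2 * #G + #Q ^ 2 * (Fintype.card α - 3).factorial := by
        gcongr
        rw [sq, ← card_product]
        exact card_filter_le _ _

lemma IsQuadratic.card_mul_le_of_subset_largeCosets {f : Perm α → ℝ} (hf : IsQuadratic f)
    (hα : 50 ≤ Fintype.card α) {c : ℝ} (hc : 0 < c) {Q : Finset (α × α × α × α)}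
    (hQ : Q ⊆ largeCosets f c) :
    #Q * ((Fintype.card α - 2).factorial - 48 * (∑ σ, |f σ|) / (Fintype.card α * c)) ≤
      4 * (∑ σ, |f σ|) / c + #Q ^ 2 * (Fintype.card α - 3).factorial := by
  set G : Finset (Perm α) := {σ | c / 2 ≤ |f σ|}
  have hG : 2 * (#G : ℝ) ≤ 4 * (∑ σ, |f σ|) / c := by
    have hsum : #G * (c / 2) ≤ ∑ σ, |f σ| := by
      rw [← nsmul_eq_mul]
      exact (card_nsmul_le_sum _ _ _ fun σ hσ => (mem_filter.1 hσ).2).trans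
        (sum_le_sum_of_subset_of_nonneg (subset_univ _) fun _ _ _ => abs_nonneg _)
    rw [le_div_iff₀ hc]
    linarith
  calc (#Q : ℝ) * ((Fintype.card α - 2).factorial -
        48 * (∑ σ, |f σ|) / (Fintype.card α * c))
      ≤ ∑ q ∈ Q, (#(G ∩ pairCoset q.1 q.2.1 q.2.2.1 q.2.2.2) : ℝ) := by
        rw [← nsmul_eq_mul]
        refine card_nsmul_le_sum _ _ _ fun q hq => ?_
        rw [filter_inter, univ_inter]
        exact hf.sub_le_card_of_mem_largeCosets hα hc (hQ hq)
    _ ≤ 2 * #G + #Q ^ 2 * (Fintype.card α - 3).factorial := by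
        exact_mod_cast sum_card_pairCoset_inter_le (fun q hq => (mem_largeCosets.1 (hQ hq)).1) G
    _ ≤ _ := by gcongr

theorem IsQuadratic.card_largeCosets_lt {f : Perm α → ℝ} (hf : IsQuadratic f)
    (hα : 50 ≤ Fintype.card α) {c K : ℝ} (hc : 0 < c)
    (hK : ∑ σ, |f σ| ≤ K * (Fintype.card α - 2).factorial) {m : ℕ} (hm : 8 * K < c * m)
    (hcα : 192 * K ≤ c * Fintype.card α) (hmα : 4 * m + 2 ≤ Fintype.card α) :
    #(largeCosets f c) < m := by
  by_contra! hle
  obtain ⟨Q, hQ, rfl⟩ := exists_subset_card_eq hle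
  have hcard := hf.card_mul_le_of_subset_largeCosets hα hc hQ
  set N := Fintype.card α
  have hN : (0 : ℝ) < N := by exact_mod_cast (by omega : 0 < N)
  have hfact : ((N - 2).factorial : ℝ) = (N - 2 : ℕ) * (N - 3).factorial := by
    rw [show N - 2 = N - 3 + 1 by omega, Nat.factorial_succ]
    push_cast
    rfl
  have hmass : 48 * (∑ σ, |f σ|) / (N * c) ≤ (N - 2).factorial / 4 := by
    rw [div_le_iff₀ (by positivity)]
    nlinarith [mul_le_mul_of_nonneg_right hcα (Nat.cast_nonneg (α := ℝ) (N - 2).factorial)]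
  have hunion : 4 * (∑ σ, |f σ|) / c < #Q * (N - 2).factorial / 2 := by
    rw [div_lt_iff₀ hc]
    nlinarith [mul_lt_mul_of_pos_right hm (by positivity : (0 : ℝ) < (N - 2).factorial)]
  have hoverlap : (#Q : ℝ) ^ 2 * (N - 3).factorial ≤ #Q * (N - 2).factorial / 4 := by
    have : 4 * (#Q : ℝ) ≤ (N - 2 : ℕ) := by exact_mod_cast (by omega : 4 * #Q ≤ N - 2)
    rw [hfact]
    nlinarith [mul_le_mul_of_nonneg_right this (by positivity : (0 : ℝ) ≤ #Q * (N - 3).factorial)]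
  nlinarith [mul_le_mul_of_nonneg_left hmass (Nat.cast_nonneg (α := ℝ) #Q)]

end LargeCosets

/-! ### Undoing several transpositions at once -/

section SwapsOn

variable {α ι : Type*}

/-- The permutation `t` exchanges `u (inl r)` and `u (inr r)` for `r ∈ D` and fixes everything
else. -/
structure SwapsOn (u : ι ⊕ ι → α) (D : Finset ι) (t : Perm α) : Prop where
  left : ∀ r ∈ D, t (u (.inl r)) = u (.inr r)
  right : ∀ r ∈ D, t (u (.inr r)) = u (.inl r)
  other : ∀ x, (∀ r ∈ D, x ≠ u (.inl r) ∧ x ≠ u (.inr r)) → t x = x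

lemma swapsOn_one (u : ι ⊕ ι → α) : SwapsOn u ∅ 1 := by
  constructor <;> simp

variable {u : ι ⊕ ι → α} {D : Finset ι} {t : Perm α}

lemma nodup_inl_inr (hu : u.Injective) {r s : ι} (hrs : r ≠ s) :
    [u (.inl r), u (.inr r), u (.inl s), u (.inr s)].Nodup :=
  (show [Sum.inl r, .inr r, .inl s, .inr s].Nodup by simp [hrs]).map hu

lemma SwapsOn.left_of_notMem (ht : SwapsOn u D t) (hu : u.Injective) {r : ι} (hr : r ∉ D) :
    t (u (.inl r)) = u (.inl r) :=
  ht.other _ fun s hs => ⟨hu.ne fun h => hr (Sum.inl_injective h ▸ hs), hu.ne (by simp)⟩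

lemma SwapsOn.right_of_notMem (ht : SwapsOn u D t) (hu : u.Injective) {r : ι} (hr : r ∉ D) :
    t (u (.inr r)) = u (.inr r) :=
  ht.other _ fun s hs => ⟨hu.ne (by simp), hu.ne fun h => hr (Sum.inr_injective h ▸ hs)⟩

variable [DecidableEq α] [DecidableEq ι]

lemma SwapsOn.mul_swap (ht : SwapsOn u D t) (hu : u.Injective) {r : ι} (hr : r ∉ D) :
    SwapsOn u (insert r D) (t * swap (u (.inl r)) (u (.inr r))) := by
  refine ⟨fun s hs => ?_, fun s hs => ?_, fun x hx => ?_⟩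
  · rcases mem_insert.1 hs with rfl | hsD
    · rw [Perm.mul_apply, swap_apply_left, ht.right_of_notMem hu hr]
    · have hsr : s ≠ r := fun h => hr (h ▸ hsD)
      rw [Perm.mul_apply, swap_apply_of_ne_of_ne (hu.ne (by simpa)) (hu.ne (by simp)),
        ht.left s hsD]
  · rcases mem_insert.1 hs with rfl | hsD
    · rw [Perm.mul_apply, swap_apply_right, ht.left_of_notMem hu hr]
    · have hsr : s ≠ r := fun h => hr (h ▸ hsD)
      rw [Perm.mul_apply, swap_apply_of_ne_of_ne (hu.ne (by simp)) (hu.ne (by simpa)),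
        ht.right s hsD]
  · simp only [forall_mem_insert] at hx
    rw [Perm.mul_apply, swap_apply_of_ne_of_ne hx.1.1 hx.1.2, ht.other x hx.2]

omit [DecidableEq ι] in
lemma exists_swapsOn (hu : u.Injective) (D : Finset ι) :
    ∃ t, SwapsOn u D t ∧ ∀ σ : Perm α, (σ * t).permMatrix ℝ = σ.permMatrix ℝ -
      ∑ r ∈ D, rect (u (.inl r)) (u (.inr r)) (σ (u (.inl r))) (σ (u (.inr r))) := by
  classical
  induction D using Finset.induction_on with
  | empty => exact ⟨1, swapsOn_one u, by simp⟩
  | insert r D hr ih =>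
    obtain ⟨t, ht, hσt⟩ := ih
    refine ⟨_, ht.mul_swap hu hr, fun σ => ?_⟩
    rw [← mul_assoc, permMatrix_mul_swap _ (hu.ne (by simp)), hσt σ, sum_insert hr, Perm.mul_apply,
      Perm.mul_apply, ht.left_of_notMem hu hr, ht.right_of_notMem hu hr]
    abel

lemma secDiff_conj (f : Perm α → ℝ) (ω σ : Perm α) (i a j b : α) :
    secDiff f (ω * σ * ω⁻¹) (ω i) (ω a) (ω j) (ω b) =
      secDiff (fun ρ => f (ω * ρ * ω⁻¹)) σ i a j b := by
  simp only [secDiff, swap_apply_apply, mul_assoc, inv_mul_cancel_left]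

lemma IsQuadratic.comp_conj {f : Perm α → ℝ} (hf : IsQuadratic f) (ω : Perm α) :
    IsQuadratic fun σ => f (ω * σ * ω⁻¹) := by
  obtain ⟨B, hB⟩ := hf
  let relabel := (Matrix.reindexLinearEquiv ℝ ℝ ω ω).toLinearMap
  refine ⟨B.compl₁₂ relabel relabel, fun σ => ?_⟩
  have hrelabel : relabel (σ.permMatrix ℝ) = (ω * σ * ω⁻¹).permMatrix ℝ := by
    ext x y
    simp [relabel, PEquiv.toMatrix_apply, Perm.inv_def, Equiv.eq_symm_apply]
  simp only [hB, LinearMap.compl₁₂_apply, hrelabel]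

variable [Fintype ι]

lemma bilin_add_sum_eq {M : Type*} [AddCommGroup M] [Module ℝ M]
    (B : M →ₗ[ℝ] M →ₗ[ℝ] ℝ) (Q : M) (R : ι → M) :
    B (Q + ∑ r, R r) (Q + ∑ r, R r) = B Q Q + ∑ r, (B (Q + R r) (Q + R r) - B Q Q) +
      1 / 2 * ∑ r, ∑ s ∈ univ.erase r, (B + B.flip) (R r) (R s) := by
  have herase : ∀ r, ∑ s ∈ univ.erase r, (B + B.flip) (R r) (R s) =
      ∑ s, (B (R r) (R s) + B (R s) (R r)) - 2 * B (R r) (R r) := by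
    intro r
    rw [← add_sum_erase _ _ (mem_univ r)]
    simp only [LinearMap.add_apply, LinearMap.flip_apply]
    ring
  have hdiag : ∀ r, B (Q + R r) (Q + R r) - B Q Q = B Q (R r) + B (R r) Q + B (R r) (R r) := by
    intro r
    simp only [map_add, LinearMap.add_apply]
    ring
  have hswap : ∑ r, ∑ s, B (R s) (R r) = ∑ r, ∑ s, B (R r) (R s) := sum_comm
  simp only [herase, hdiag, sum_add_distrib, sum_sub_distrib, ← mul_sum, hswap]
  simp only [map_add, map_sum, LinearMap.add_apply, LinearMap.sum_apply, sum_add_distrib, hswap]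
  ring

lemma IsQuadratic.exists_swapsOn_expansion {f : Perm α → ℝ} (hf : IsQuadratic f)
    (hu : u.Injective) :
    ∃ (t : Perm α) (t' : ι → Perm α), SwapsOn u univ t ∧ (∀ r, SwapsOn u (univ.erase r) (t' r)) ∧
      ∀ ω σ : Perm α, f (ω * σ * ω⁻¹) = f (ω * (σ * t) * ω⁻¹) +
        ∑ r, (f (ω * (σ * t' r) * ω⁻¹) - f (ω * (σ * t) * ω⁻¹)) +
        1 / 2 * ∑ r, ∑ s ∈ univ.erase r, secDiff f (ω * σ * ω⁻¹)
          (ω (u (.inl r))) (ω (u (.inr r))) (ω (u (.inl s))) (ω (u (.inr s))) := by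
  obtain ⟨t, ht, hσt⟩ := exists_swapsOn hu univ
  choose t' ht' hσt' using fun r : ι => exists_swapsOn hu (univ.erase r)
  refine ⟨t, t', ht, ht', fun ω σ => ?_⟩
  obtain ⟨B, hB⟩ := hf.comp_conj ω
  let R (r : ι) := rect (u (.inl r)) (u (.inr r)) (σ (u (.inl r))) (σ (u (.inr r)))
  have hσ : σ.permMatrix ℝ = (σ * t).permMatrix ℝ + ∑ r, R r := by simp [hσt, R]
  have hσr : ∀ r, (σ * t' r).permMatrix ℝ = (σ * t).permMatrix ℝ + R r := by
    intro r
    rw [hσt', hσ, ← add_sum_erase _ _ (mem_univ r)]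
    simp only [R]
    abel
  have hsec : ∀ r, ∀ s ∈ univ.erase r, secDiff f (ω * σ * ω⁻¹)
      (ω (u (.inl r))) (ω (u (.inr r))) (ω (u (.inl s))) (ω (u (.inr s))) =
      (B + B.flip) (R r) (R s) := by
    intro r s hs
    rw [secDiff_conj, secDiff_eq hB _ (nodup_inl_inr hu (ne_of_mem_erase hs).symm)]
  rw [sum_congr rfl fun r _ => sum_congr rfl (hsec r)]
  simp only [hB, hσr]
  rw [hσ]
  exact bilin_add_sum_eq B _ R

lemma SwapsOn.mul_mem_exactlyFixing [Fintype α] (ht : SwapsOn u D t) (hu : u.Injective)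
    {π : Perm α} (hπ : π ∈ exactlyFixing (univ.image (u ∘ Sum.inl))) :
    π * t ∈ exactlyFixing (Dᶜ.image (u ∘ Sum.inl)) := by
  simp only [mem_exactlyFixing, mem_image, mem_univ, true_and, Function.comp_apply, mem_compl]
    at hπ ⊢
  have hfix : ∀ r, π (u (.inl r)) = u (.inl r) := fun r => (hπ _).2 ⟨r, rfl⟩
  intro x
  rw [Perm.mul_apply]
  by_cases hx : ∀ r ∈ D, x ≠ u (.inl r) ∧ x ≠ u (.inr r)
  · rw [ht.other x hx, hπ]
    exact ⟨fun ⟨r, hr⟩ => ⟨r, fun hrD => (hx r hrD).1 hr.symm, hr⟩, fun ⟨r, _, hr⟩ => ⟨r, hr⟩⟩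
  push Not at hx
  obtain ⟨r, hr, hxr⟩ := hx
  refine iff_of_false (fun h => ?_) fun ⟨s, hs, hsx⟩ => ?_
  · by_cases hxl : x = u (.inl r)
    · subst hxl
      rw [ht.left r hr] at h
      exact Sum.inr_ne_inl (hu (π.injective (h.trans (hfix r).symm)))
    · rw [hxr hxl, ht.right r hr, hfix] at h
      exact Sum.inl_ne_inr (hu h)
  · subst hsx
    by_cases hsr : s = r
    · exact hs (hsr ▸ hr)
    · exact Sum.inl_ne_inr (hu (hxr (hu.ne (by simpa))))

lemma SwapsOn.conj_mul_apply [Fintype α] (ht : SwapsOn u D t) (hu : u.Injective)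
    {π : Perm α} (hπ : π ∈ exactlyFixing (univ.image (u ∘ Sum.inl))) (ω : Perm α) (r : ι) :
    (ω * (π * t) * ω⁻¹) (ω (u (if r ∈ D then .inr r else .inl r))) = ω (u (.inl r)) := by
  have hfix : π (u (.inl r)) = u (.inl r) := (mem_exactlyFixing.1 hπ _).2 (by simp)
  split_ifs with hr
  · simp [ht.right r hr, hfix]
  · simp [ht.left_of_notMem hu hr, hfix]

lemma SwapsOn.fixCard_conj_mul [Fintype α] (ht : SwapsOn u D t) (hu : u.Injective)
    {π : Perm α} (hπ : π ∈ exactlyFixing (univ.image (u ∘ Sum.inl))) (ω : Perm α) :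
    fixCard (ω * (π * t) * ω⁻¹) = #Dᶜ := by
  rw [fixCard_conj, fixCard_of_mem_exactlyFixing (ht.mul_mem_exactlyFixing hu hπ),
    card_image_of_injective _ (hu.comp Sum.inl_injective)]

/-- Knowing `σ = ω * (π * t) * ω⁻¹`, the values `ω (u (inr r))` determine `ω (u (inl r))` for
`r ∈ D`, while for `r ∉ D` the latter is one of the `#Dᶜ` fixed points of `σ`. -/
lemma SwapsOn.card_conj_mul_eq_le [Fintype α] (ht : SwapsOn u D t) (hu : u.Injective)
    {A : Finset (Perm α)} (hA : A ⊆ exactlyFixing (univ.image (u ∘ Sum.inl))) (σ : Perm α) :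
    #{z ∈ univ ×ˢ A | z.1 * (z.2 * t) * z.1⁻¹ = σ} ≤
      (Fintype.card α - 2 * Fintype.card ι).factorial *
        (Fintype.card α ^ Fintype.card ι * #Dᶜ ^ #Dᶜ) := by
  set P := {z ∈ (univ : Finset (Perm α)) ×ˢ A | z.1 * (z.2 * t) * z.1⁻¹ = σ}
  have hPσ : ∀ z ∈ P, z.1 * (z.2 * t) * z.1⁻¹ = σ := fun z hz => (mem_filter.1 hz).2
  have hPA : ∀ z ∈ P, z.2 ∈ exactlyFixing (univ.image (u ∘ Sum.inl)) := fun z hz =>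
    hA (mem_product.1 (mem_filter.1 hz).1).2
  obtain hempty | ⟨z₀, hz₀⟩ := P.eq_empty_or_nonempty
  · simp [hempty]
  have hcard : #{x | σ x = x} = #Dᶜ := by
    rw [← hPσ z₀ hz₀]
    exact ht.fixCard_conj_mul hu (hPA z₀ hz₀) z₀.1
  have hleft : ∀ z ∈ P, ∀ r, σ (z.1 (u (if r ∈ D then .inr r else .inl r))) = z.1 (u (.inl r)) :=
    fun z hz r => hPσ z hz ▸ ht.conj_mul_apply hu (hPA z hz) z.1 r
  let Y := (univ : Finset (ι → α)) ×ˢ Fintype.piFinset fun _ : ↥Dᶜ => ({x | σ x = x} : Finset α)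
  have hY : #Y = Fintype.card α ^ Fintype.card ι * #Dᶜ ^ #Dᶜ := by simp [Y, hcard]
  rw [← hY]
  refine card_le_mul_card_image_of_maps_to
    (f := fun z : Perm α × Perm α => (fun r => z.1 (u (.inr r)), fun r : ↥Dᶜ => z.1 (u (.inl r))))
    (fun z hz => ?_) _ fun y _ => ?_
  · simp only [Y, mem_product, mem_univ, true_and, Fintype.mem_piFinset, mem_filter]
    exact fun r => by simpa [mem_compl.1 r.2] using hleft z hz r
  let v : ι ⊕ ι → α :=
    Sum.elim (fun r => if hr : r ∈ Dᶜ then y.2 ⟨r, hr⟩ else σ (y.1 r)) y.1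
  calc _ ≤ #{ω : Perm α | ∀ r, ω (u r) = v r} := by
        refine card_le_card_of_injOn Prod.fst (fun z hz => ?_) fun z hz w hw hzw => ?_
        · obtain ⟨hzP, rfl⟩ := mem_filter.1 hz
          refine mem_coe.2 (mem_filter.2 ⟨mem_univ _, ?_⟩)
          rintro (r | r)
          · by_cases hr : r ∈ D
            · simpa [v, hr] using (hleft z hzP r).symm
            · simp [v, hr]
          · rfl
        · have hzw' := (hPσ z (mem_filter.1 hz).1).trans (hPσ w (mem_filter.1 hw).1).symm
          rw [hzw] at hzw'
          exact Prod.ext hzw (mul_right_cancel (mul_left_cancel (mul_right_cancel hzw')))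
    _ ≤ _ := by
        simpa [two_mul] using card_perm_forall_apply_eq_le hu v

lemma SwapsOn.sum_abs_conj_mul_le [Fintype α] (ht : SwapsOn u D t) (hu : u.Injective)
    {A : Finset (Perm α)} (hA : A ⊆ exactlyFixing (univ.image (u ∘ Sum.inl))) (f : Perm α → ℝ) :
    ∑ z ∈ univ ×ˢ A, |f (z.1 * (z.2 * t) * z.1⁻¹)| ≤
      ((Fintype.card α - 2 * Fintype.card ι).factorial *
        (Fintype.card α ^ Fintype.card ι * #Dᶜ ^ #Dᶜ) : ℕ) * ∑ σ, |f σ| := by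
  rw [mul_sum, ← sum_fiberwise (univ ×ˢ A) fun z => z.1 * (z.2 * t) * z.1⁻¹]
  refine sum_le_sum fun σ _ => ?_
  calc _ = #{z ∈ univ ×ˢ A | z.1 * (z.2 * t) * z.1⁻¹ = σ} * |f σ| := by
        rw [← nsmul_eq_mul, ← sum_const]
        exact sum_congr rfl fun z hz => by rw [(mem_filter.1 hz).2]
    _ ≤ _ := by
        gcongr
        exact ht.card_conj_mul_eq_le hu hA σ

end SwapsOn

/-! ### Second differences at conjugates -/

section Anchored

lemma sum_cornerSign_mul_le {g : Bool × Bool × Bool × Bool → ℝ} {c : ℝ}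
    (hid : g (false, false, false, false) ≤ c)
    (hother : ∀ p ≠ (false, false, false, false), |g p| ≤ c) :
    ∑ p, cornerSign p * g p ≤ 16 * c := by
  have hterm : ∀ p ∈ univ, cornerSign p * g p ≤ c := by
    intro p _
    obtain rfl | hp := eq_or_ne p (false, false, false, false)
    · simpa [cornerSign] using hid
    · refine (le_abs_self _).trans ?_
      rw [abs_mul, abs_cornerSign, one_mul]
      exact hother p hp
  simpa using sum_le_card_nsmul _ _ _ hterm

variable {α : Type*}

lemma corner_conj (ω π : Perm α) (i a j b : α) (p : Bool × Bool × Bool × Bool) :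
    corner (ω * π * ω⁻¹) (ω i) (ω a) (ω j) (ω b) p =
      (ω (corner π i a j b p).1, ω (corner π i a j b p).2.1,
        ω (corner π i a j b p).2.2.1, ω (corner π i a j b p).2.2.2) := by
  obtain ⟨p, q, r, s⟩ := p
  cases p <;> cases q <;> cases r <;> cases s <;> simp [corner]

lemma corner_notMem_pair {π : Perm α} {i a j b : α} (hd : [i, a, j, b].Nodup) (hi : π i = i)
    (hj : π j = j) (ha : π a ≠ a ∧ π a ≠ b) (hb : π b ≠ a ∧ π b ≠ b)
    {p : Bool × Bool × Bool × Bool} (hp : p ≠ (false, false, false, false)) :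
    ((corner π i a j b p).2.2.1 ≠ (corner π i a j b p).1 ∧
        (corner π i a j b p).2.2.1 ≠ (corner π i a j b p).2.1) ∨
      ((corner π i a j b p).2.2.2 ≠ (corner π i a j b p).1 ∧
        (corner π i a j b p).2.2.2 ≠ (corner π i a j b p).2.1) := by
  have hne : ∀ {x y}, π y = y → x ≠ y → π x ≠ y := fun hy hxy h =>
    hxy (π.injective (h.trans hy.symm))
  simp only [List.nodup_cons, List.mem_cons, List.not_mem_nil, or_false, not_or] at hd
  obtain ⟨⟨hia, hij, hib⟩, ⟨haj, hab⟩, hjb, -⟩ := hd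
  have hai := hne hi (Ne.symm hia)
  have hbi := hne hi (Ne.symm hib)
  have haj' := hne hj haj
  have hbj := hne hj (Ne.symm hjb)
  obtain ⟨p, q, r, s⟩ := p
  revert hp
  cases p <;> cases q <;> cases r <;> cases s <;> simp [corner, *, Ne.symm]

variable [Fintype α] [DecidableEq α]

lemma card_filter_apply_mem_le (Q : Finset (α × α × α × α)) {x y z w : α} (hxy : x ≠ y)
    (hzw : (z ≠ x ∧ z ≠ y) ∨ (w ≠ x ∧ w ≠ y)) :
    #{ω : Perm α | (ω x, ω y, ω z, ω w) ∈ Q} ≤ #Q * (Fintype.card α - 3).factorial := by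
  have htriple : ∀ {v}, v ≠ x ∧ v ≠ y → ∀ k l m,
      #{ω : Perm α | ω x = k ∧ ω y = l ∧ ω v = m} ≤ (Fintype.card α - 3).factorial := by
    intro v hv k l m
    have hinj : Function.Injective ![x, y, v] := by
      rw [← List.nodup_ofFn]
      simpa using ⟨⟨hxy, hv.1.symm⟩, hv.2.symm⟩
    simpa [Fin.forall_fin_succ] using card_perm_forall_apply_eq_le hinj ![k, l, m]
  rw [mul_comm]
  refine card_le_mul_card_image_of_maps_to (f := fun ω : Perm α => (ω x, ω y, ω z, ω w))
    (fun ω hω => (mem_filter.1 hω).2) _ ?_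
  rintro ⟨k, l, m, m'⟩ -
  obtain h | h := hzw
  · refine (card_le_card fun ω hω => ?_).trans (htriple h k l m)
    simp only [mem_filter, mem_univ, true_and, Prod.mk.injEq] at hω ⊢
    tauto
  · refine (card_le_card fun ω hω => ?_).trans (htriple h k l m')
    simp only [mem_filter, mem_univ, true_and, Prod.mk.injEq] at hω ⊢
    tauto

lemma card_filter_corner_conj_mem_le (Q : Finset (α × α × α × α)) {π : Perm α} {i a j b : α}
    (hd : [i, a, j, b].Nodup) (hi : π i = i) (hj : π j = j) (ha : π a ≠ a ∧ π a ≠ b)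
    (hb : π b ≠ a ∧ π b ≠ b) :
    #{ω : Perm α | ∃ p ≠ (false, false, false, false),
      corner (ω * π * ω⁻¹) (ω i) (ω a) (ω j) (ω b) p ∈ Q} ≤
      16 * (#Q * (Fintype.card α - 3).factorial) := by
  calc _ ≤ #((univ.erase (false, false, false, false)).biUnion fun p => {ω : Perm α |
        corner (ω * π * ω⁻¹) (ω i) (ω a) (ω j) (ω b) p ∈ Q}) := by
        refine card_le_card fun ω hω => ?_
        simpa using hω
    _ ≤ #(univ.erase (false, false, false, false)) * (#Q * (Fintype.card α - 3).factorial) := by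
        refine card_biUnion_le_card_mul _ _ _ fun p hp => ?_
        simp only [corner_conj]
        exact card_filter_apply_mem_le Q (corner_ne π hd p).1
          (corner_notMem_pair hd hi hj ha hb (ne_of_mem_erase hp))
    _ ≤ _ := Nat.mul_le_mul_right _ (by decide)

lemma IsQuadratic.secDiff_le_of_corner {f : Perm α → ℝ} (hf : IsQuadratic f)
    (hα : 50 ≤ Fintype.card α) {c K : ℝ} (hK : ∑ σ, |f σ| ≤ K * (Fintype.card α - 2).factorial)
    {σ : Perm α} {i a j b : α} (hd : [i, a, j, b].Nodup)
    (hid : cosetAverage f (corner σ i a j b (false, false, false, false)) ≤ c)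
    (hother : ∀ p ≠ (false, false, false, false), |cosetAverage f (corner σ i a j b p)| ≤ c) :
    secDiff f σ i a j b ≤ 16 * c + 1728 * K / Fintype.card α := by
  have hbound : 1728 * (∑ σ, |f σ|) / (Fintype.card α * (Fintype.card α - 2).factorial) ≤
      1728 * K / Fintype.card α := by
    rw [div_mul_eq_div_div_swap, mul_div_assoc]
    gcongr
    rwa [div_le_iff₀ (by positivity)]
  linarith [le_of_abs_le (hf.abs_secDiff_sub_le hα σ hd), sum_cornerSign_mul_le hid hother]

/-- At a conjugate of `π`, only the identity corner is a coset `pairCoset i j i j`, whose average is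
bounded from one side; each of the other corners is rarely in `largeCosets f c`. -/
lemma IsQuadratic.sum_secDiff_conj_le {f : Perm α → ℝ} (hf : IsQuadratic f)
    (hα : 50 ≤ Fintype.card α) {c K : ℝ} (hc : 0 ≤ c)
    (hK : ∑ σ, |f σ| ≤ K * (Fintype.card α - 2).factorial)
    (hcoset : ∀ q : α × α × α × α, q.1 ≠ q.2.1 → q.2.2.1 ≠ q.2.2.2 → cosetAverage f q ≤ c)
    {π : Perm α} {i a j b : α} (hd : [i, a, j, b].Nodup) (hi : π i = i) (hj : π j = j)
    (ha : π a ≠ a ∧ π a ≠ b) (hb : π b ≠ a ∧ π b ≠ b) (W : Finset (Perm α)) :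
    ∑ ω ∈ W, secDiff f (ω * π * ω⁻¹) (ω i) (ω a) (ω j) (ω b) ≤
      #W * (16 * c + 1728 * K / Fintype.card α) +
        16 * (#(largeCosets f c) * (Fintype.card α - 3).factorial) *
          (16 * K + 1728 * K / Fintype.card α) := by
  set E := 16 * K + 1728 * K / Fintype.card α
  let X : Finset (Perm α) := {ω | ∃ p ≠ (false, false, false, false),
    corner (ω * π * ω⁻¹) (ω i) (ω a) (ω j) (ω b) p ∈ largeCosets f c}
  have habs : ∀ q, |cosetAverage f q| ≤ K := fun q =>
    (abs_cosetAverage_le f q).trans (by rwa [div_le_iff₀ (by positivity)])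
  have hK₀ : 0 ≤ K := (abs_nonneg _).trans (habs (i, i, i, i))
  have hE : 0 ≤ E := by positivity
  have hpoint : ∀ ω ∈ W, secDiff f (ω * π * ω⁻¹) (ω i) (ω a) (ω j) (ω b) ≤
      16 * c + 1728 * K / Fintype.card α + if ω ∈ X then E else 0 := by
    intro ω _
    have hdω := hd.map ω.injective
    split_ifs with hω
    · have hle := hf.secDiff_le_of_corner (σ := ω * π * ω⁻¹) hα hK hdω
        (le_of_abs_le (habs _)) fun p _ => habs _
      have : 0 ≤ 16 * c + 1728 * K / Fintype.card α := by positivity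
      linarith
    · rw [add_zero]
      have hne := corner_ne (ω * π * ω⁻¹) hdω
      refine hf.secDiff_le_of_corner hα hK hdω (hcoset _ (hne _).1 (hne _).2) fun p hp => ?_
      by_contra! hlt
      exact hω (mem_filter.2 ⟨mem_univ ω, p, hp,
        mem_largeCosets.2 ⟨(hne p).1, (hne p).2, hlt.le⟩⟩)
  have hX : (#X : ℝ) ≤ 16 * (#(largeCosets f c) * (Fintype.card α - 3).factorial) := by
    exact_mod_cast card_filter_corner_conj_mem_le _ hd hi hj ha hb
  calc _ ≤ _ := sum_le_sum hpoint
    _ = #W * (16 * c + 1728 * K / Fintype.card α) + #{ω ∈ W | ω ∈ X} * E := by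
        rw [sum_add_distrib, sum_const, nsmul_eq_mul, ← sum_filter, sum_const, nsmul_eq_mul]
    _ ≤ _ := by
        gcongr
        refine le_trans ?_ hX
        exact_mod_cast card_le_card fun ω hω => (mem_filter.1 hω).2

variable {ι : Type*} [Fintype ι]

/-- The permutations whose fixed points are exactly the `u (inl r)` and which map the set of the
`u (inr r)` into its complement. -/
def anchored (u : ι ⊕ ι → α) : Finset (Perm α) :=
  {π ∈ exactlyFixing (univ.image (u ∘ Sum.inl)) | ∀ r s, π (u (.inr r)) ≠ u (.inr s)}

variable {u : ι ⊕ ι → α}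

lemma anchored_subset : anchored u ⊆ exactlyFixing (univ.image (u ∘ Sum.inl)) :=
  filter_subset _ _

lemma apply_inl_of_mem_anchored {π : Perm α} (hπ : π ∈ anchored u) (r : ι) :
    π (u (.inl r)) = u (.inl r) :=
  (mem_exactlyFixing.1 (anchored_subset hπ) _).2 (by simp)

lemma numDerangements_le_card_anchored_add (hu : u.Injective) :
    numDerangements (Fintype.card α - Fintype.card ι) ≤ #(anchored u) +
      Fintype.card ι ^ 2 * (Fintype.card α - Fintype.card ι - 1).factorial := by
  set E := exactlyFixing (univ.image (u ∘ Sum.inl))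
  let X (p : ι × ι) : Finset (Perm α) := {π ∈ E | π (u (.inr p.1)) = u (.inr p.2)}
  have hX : ∀ p ∈ univ, #(X p) ≤ (Fintype.card α - Fintype.card ι - 1).factorial := by
    intro p _
    let v (y : α) : Option ι → α := fun o => o.elim y (u ∘ Sum.inl)
    have hv : (v (u (.inr p.1))).Injective := by
      rintro (_ | r) (_ | s) h <;> simp_all [v, hu.eq_iff]
    refine (card_le_card fun π hπ => ?_).trans
      ((card_perm_forall_apply_eq_le hv (v (u (.inr p.2)))).trans_eq ?_)
    · obtain ⟨hE, hp⟩ := mem_filter.1 hπ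
      refine mem_filter.2 ⟨mem_univ π, ?_⟩
      rintro (_ | r)
      · exact hp
      · exact (mem_exactlyFixing.1 hE _).2 (by simp [v])
    · rw [Fintype.card_option, Nat.sub_sub]
  calc _ = #E := by
        rw [card_exactlyFixing, card_image_of_injective _ (hu.comp Sum.inl_injective), card_univ]
    _ ≤ #(anchored u ∪ univ.biUnion X) := by
        refine card_le_card fun π hπ => ?_
        by_cases h : ∀ r s, π (u (.inr r)) ≠ u (.inr s)
        · exact mem_union_left _ (mem_filter.2 ⟨hπ, h⟩)
        · push Not at h
          obtain ⟨r, s, hrs⟩ := h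
          exact mem_union_right _ (mem_biUnion.2 ⟨(r, s), mem_univ _, mem_filter.2 ⟨hπ, hrs⟩⟩)
    _ ≤ #(anchored u) + #(univ.biUnion X) := card_union_le _ _
    _ ≤ _ := by
        gcongr
        refine (card_biUnion_le_card_mul _ _ _ hX).trans_eq ?_
        rw [card_univ, Fintype.card_prod, sq]

lemma factorial_le_four_mul_card_anchored (hu : u.Injective)
    (hα : 12 * Fintype.card ι ^ 2 + Fintype.card ι + 2 ≤ Fintype.card α) :
    (Fintype.card α - Fintype.card ι).factorial ≤ 4 * #(anchored u) := by
  have hcard := numDerangements_le_card_anchored_add hu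
  obtain ⟨m, hm⟩ : ∃ m, Fintype.card α - Fintype.card ι = m + 1 :=
    Nat.exists_eq_add_one.2 (by omega)
  have hder := factorial_le_three_mul_numDerangements (m := m + 1) (by omega)
  rw [hm] at hcard ⊢
  rw [Nat.add_sub_cancel] at hcard
  have hsmall : 12 * (Fintype.card ι ^ 2 * m.factorial) ≤ (m + 1).factorial := by
    rw [Nat.factorial_succ, ← mul_assoc]
    exact Nat.mul_le_mul_right _ (by omega)
  omega

end Anchored

/-! ### Averaging over conjugates of anchored permutations -/

section AnchoredAverage

variable {α ι : Type*} [Fintype α] [DecidableEq α] [Fintype ι] {u : ι ⊕ ι → α} {f : Perm α → ℝ}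

lemma IsQuadratic.sum_conj_le [DecidableEq ι] (hf : IsQuadratic f) (hu : u.Injective)
    {A : Finset (Perm α)} (hA : A ⊆ exactlyFixing (univ.image (u ∘ Sum.inl)))
    {P : Finset (Perm α × Perm α)} (hP : P ⊆ univ ×ˢ A) :
    ∑ z ∈ P, f (z.1 * z.2 * z.1⁻¹) ≤
      (2 * Fintype.card ι + 1) * (((Fintype.card α - 2 * Fintype.card ι).factorial *
        Fintype.card α ^ Fintype.card ι : ℕ) * ∑ σ, |f σ|) +
      1 / 2 * ∑ r, ∑ s ∈ univ.erase r, ∑ z ∈ P, secDiff f (z.1 * z.2 * z.1⁻¹)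
        (z.1 (u (.inl r))) (z.1 (u (.inr r))) (z.1 (u (.inl s))) (z.1 (u (.inr s))) := by
  obtain ⟨t, t', ht, ht', hexp⟩ := hf.exists_swapsOn_expansion hu
  set L := (((Fintype.card α - 2 * Fintype.card ι).factorial *
    Fintype.card α ^ Fintype.card ι : ℕ) * ∑ σ, |f σ| : ℝ)
  have hswaps : ∀ {D t}, SwapsOn u D t → #Dᶜ ≤ 1 →
      |∑ z ∈ P, f (z.1 * (z.2 * t) * z.1⁻¹)| ≤ L := by
    intro D t ht hD
    have hpow : #Dᶜ ^ #Dᶜ = 1 := by interval_cases #Dᶜ <;> rfl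
    have hle := ht.sum_abs_conj_mul_le hu hA f
    rw [hpow, mul_one] at hle
    exact (abs_sum_le_sum_abs _ _).trans
      ((sum_le_sum_of_subset_of_nonneg hP fun _ _ _ => abs_nonneg _).trans hle)
  have ht₀ := abs_le.1 (hswaps ht (by simp))
  have hsum : ∑ r, (∑ z ∈ P, f (z.1 * (z.2 * t' r) * z.1⁻¹) -
      ∑ z ∈ P, f (z.1 * (z.2 * t) * z.1⁻¹)) ≤ Fintype.card ι * (2 * L) := by
    rw [← nsmul_eq_mul]
    refine sum_le_card_nsmul _ _ _ fun r _ => ?_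
    have := le_of_abs_le (hswaps (ht' r) (by simp [compl_erase]))
    linarith
  have htotal : ∑ z ∈ P, f (z.1 * z.2 * z.1⁻¹) = ∑ z ∈ P, f (z.1 * (z.2 * t) * z.1⁻¹) +
      ∑ r, (∑ z ∈ P, f (z.1 * (z.2 * t' r) * z.1⁻¹) - ∑ z ∈ P, f (z.1 * (z.2 * t) * z.1⁻¹)) +
      1 / 2 * ∑ r, ∑ s ∈ univ.erase r, ∑ z ∈ P, secDiff f (z.1 * z.2 * z.1⁻¹)
        (z.1 (u (.inl r))) (z.1 (u (.inr r))) (z.1 (u (.inl s))) (z.1 (u (.inr s))) := by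
    simp only [← sum_sub_distrib, sum_comm (s := univ.erase _) (t := P), sum_comm (t := P),
      mul_sum P, ← sum_add_distrib, ← hexp]
  linarith [ht₀.2]

lemma IsQuadratic.sum_secDiff_conj_anchored_le (hf : IsQuadratic f) (hα : 50 ≤ Fintype.card α)
    {c K : ℝ} (hc : 0 ≤ c) (hK : ∑ σ, |f σ| ≤ K * (Fintype.card α - 2).factorial)
    (hcoset : ∀ q : α × α × α × α, q.1 ≠ q.2.1 → q.2.2.1 ≠ q.2.2.2 → cosetAverage f q ≤ c)
    (hu : u.Injective) {P : Finset (Perm α × Perm α)} (hP : P ⊆ univ ×ˢ anchored u) {r s : ι}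
    (hrs : r ≠ s) :
    ∑ z ∈ P, secDiff f (z.1 * z.2 * z.1⁻¹)
        (z.1 (u (.inl r))) (z.1 (u (.inr r))) (z.1 (u (.inl s))) (z.1 (u (.inr s))) ≤
      #P * (16 * c + 1728 * K / Fintype.card α) +
        #(anchored u) * (16 * (#(largeCosets f c) * (Fintype.card α - 3).factorial) *
          (16 * K + 1728 * K / Fintype.card α)) := by
  let W (π : Perm α) : Finset (Perm α) := {ω | (ω, π) ∈ P}
  have hmem : ∀ z : Perm α × Perm α, z ∈ P ↔ z.2 ∈ anchored u ∧ z.1 ∈ W z.2 := fun z => by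
    simpa [W] using fun hz => (mem_product.1 (hP hz)).2
  have hcard : (#P : ℝ) = ∑ π ∈ anchored u, (#(W π) : ℝ) := by
    rw [card_eq_sum_ones, sum_finset_product_right P (anchored u) W hmem]
    simp
  rw [sum_finset_product_right P (anchored u) W hmem, hcard, sum_mul, ← nsmul_eq_mul, ← sum_const,
    ← sum_add_distrib]
  refine sum_le_sum fun π hπ => ?_
  have hanchored := (mem_filter.1 hπ).2
  exact hf.sum_secDiff_conj_le hα hc hK hcoset (nodup_inl_inr hu hrs)
    (apply_inl_of_mem_anchored hπ r) (apply_inl_of_mem_anchored hπ s)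
    ⟨hanchored r r, hanchored r s⟩ ⟨hanchored s r, hanchored s s⟩ _

lemma IsQuadratic.sum_conj_anchored_le (hf : IsQuadratic f) (hα : 50 ≤ Fintype.card α)
    {c K : ℝ} (hc : 0 ≤ c) (hK : ∑ σ, |f σ| ≤ K * (Fintype.card α - 2).factorial)
    (hcoset : ∀ q : α × α × α × α, q.1 ≠ q.2.1 → q.2.2.1 ≠ q.2.2.2 → cosetAverage f q ≤ c)
    (hu : u.Injective) {P : Finset (Perm α × Perm α)} (hP : P ⊆ univ ×ˢ anchored u) :
    ∑ z ∈ P, f (z.1 * z.2 * z.1⁻¹) ≤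
      (2 * Fintype.card ι + 1) * (((Fintype.card α - 2 * Fintype.card ι).factorial *
        Fintype.card α ^ Fintype.card ι : ℕ) * ∑ σ, |f σ|) +
      Fintype.card ι ^ 2 / 2 * (#P * (16 * c + 1728 * K / Fintype.card α) +
        #(anchored u) * (16 * (#(largeCosets f c) * (Fintype.card α - 3).factorial) *
          (16 * K + 1728 * K / Fintype.card α))) := by
  classical
  refine (hf.sum_conj_le hu anchored_subset hP).trans (add_le_add_right ?_ _)
  set Y : ℝ := #P * (16 * c + 1728 * K / Fintype.card α) +
    #(anchored u) * (16 * (#(largeCosets f c) * (Fintype.card α - 3).factorial) *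
      (16 * K + 1728 * K / Fintype.card α))
  have hK₀ : 0 ≤ K := nonneg_of_mul_nonneg_left
    ((sum_nonneg fun σ _ => abs_nonneg (f σ)).trans hK) (by positivity)
  have hY : 0 ≤ Y := by positivity
  have hrow : ∀ r ∈ univ, ∑ s ∈ univ.erase r, ∑ z ∈ P, secDiff f (z.1 * z.2 * z.1⁻¹)
      (z.1 (u (.inl r))) (z.1 (u (.inr r))) (z.1 (u (.inl s))) (z.1 (u (.inr s))) ≤
      Fintype.card ι • Y := by
    intro r _
    refine (sum_le_card_nsmul _ _ Y fun s hs => hf.sum_secDiff_conj_anchored_le hα hc hK hcoset hu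
      hP (ne_of_mem_erase hs).symm).trans ?_
    exact nsmul_le_nsmul_left hY (card_le_univ _)
  have hsum := sum_le_card_nsmul _ _ _ hrow
  simp only [card_univ, nsmul_eq_mul] at hsum
  linarith

end AnchoredAverage

/-! ### The sharp bound -/

section Sharp

lemma pow_le_two_mul_sub_pow {n k : ℕ} (hn : 4 * k ^ 2 ≤ n) : n ^ k ≤ 2 * (n - 2 * k) ^ k := by
  obtain rfl | hn₀ := n.eq_zero_or_pos
  · obtain rfl : k = 0 := by simpa using hn
    simp
  have hk : 2 * k ≤ n := by nlinarith
  have hn' : (0 : ℝ) < n := by exact_mod_cast hn₀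
  have hle : (2 * k / n : ℝ) ≤ 1 := by
    rw [div_le_one hn']
    exact_mod_cast hk
  have hbernoulli := one_add_mul_le_pow (a := -(2 * k / n : ℝ)) (by linarith) k
  have hhalf : (k : ℝ) * (2 * k / n) ≤ 1 / 2 := by
    rw [← mul_div_assoc, div_le_iff₀ hn']
    have : (4 * k ^ 2 : ℝ) ≤ n := by exact_mod_cast hn
    linarith
  have hfactor : ((n - 2 * k : ℕ) : ℝ) = n * (1 + -(2 * k / n)) := by
    rw [Nat.cast_sub hk]
    push_cast
    field_simp
    ring
  have hreal : (n : ℝ) ^ k ≤ 2 * ((n - 2 * k : ℕ) : ℝ) ^ k := by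
    rw [hfactor, mul_pow]
    nlinarith [pow_pos hn' k]
  exact_mod_cast hreal

lemma factorial_mul_pow_le {n k : ℕ} (hn : 4 * k ^ 2 ≤ n) :
    (n - 2 * k).factorial * n ^ k ≤ 2 * (n - k).factorial := by
  have hk : 2 * k ≤ n := by nlinarith
  have hdesc : (n - k).factorial = (n - 2 * k).factorial * (n - k).descFactorial k := by
    rw [← Nat.factorial_mul_descFactorial (by omega : k ≤ n - k), Nat.sub_sub, two_mul]
  have hpow : (n - 2 * k) ^ k ≤ (n - k).descFactorial k :=
    (Nat.pow_le_pow_left (by omega) k).trans (Nat.pow_sub_le_descFactorial (n - k) k)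
  calc _ ≤ (n - 2 * k).factorial * (2 * (n - k).descFactorial k) := by
        gcongr
        exact (pow_le_two_mul_sub_pow hn).trans (Nat.mul_le_mul_left 2 hpow)
    _ = _ := by
        rw [hdesc]
        ring

lemma factorial_div_sq_le {n : ℕ} (hn : 2 ≤ n) :
    n.factorial / (n : ℝ) ^ 2 ≤ (n - 2).factorial := by
  obtain ⟨m, rfl⟩ := Nat.exists_eq_add_of_le' hn
  rw [div_le_iff₀ (by positivity), Nat.add_sub_cancel, mul_comm]
  have : (m + 2).factorial ≤ (m + 2) ^ 2 * m.factorial := by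
    rw [Nat.factorial_succ, Nat.factorial_succ, ← mul_assoc, sq]
    gcongr
    omega
  exact_mod_cast this

lemma factorial_sub_three_le {n : ℕ} (hn : 3 ≤ n) :
    ((n - 3).factorial : ℝ) ≤ 8 * (n.factorial / (n : ℝ) ^ 2) / n := by
  obtain ⟨m, rfl⟩ := Nat.exists_eq_add_of_le' hn
  rw [mul_div_assoc, div_div, ← mul_div_assoc, le_div_iff₀ (by positivity), Nat.add_sub_cancel,
    mul_comm]
  have : (m + 3) ^ 2 * (m + 3) * m.factorial ≤ 8 * (m + 3).factorial := by
    calc _ = (m + 3) ^ 2 * ((m + 3) * m.factorial) := mul_assoc _ _ _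
      _ ≤ 8 * ((m + 2) * (m + 1)) * ((m + 3) * m.factorial) :=
        Nat.mul_le_mul_right _ (by nlinarith)
      _ = _ := by
        rw [Nat.factorial_succ, Nat.factorial_succ, Nat.factorial_succ]
        ring
  exact_mod_cast this

variable {α : Type*} [Fintype α] [DecidableEq α] {f : Perm α → ℝ} {x₀ x₁ x₂ x₃ : ℝ}

lemma IsQuadratic.sum_conjPairs_anchored_le {ι : Type*} [Fintype ι] (hf : IsQuadratic f)
    (hα : 50 ≤ Fintype.card α)
    (hια : 12 * Fintype.card ι ^ 2 + Fintype.card ι + 2 ≤ Fintype.card α) {K c : ℝ}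
    (hK : ∑ σ, |f σ| ≤ K * ((Fintype.card α).factorial / (Fintype.card α : ℝ) ^ 2)) (hc : 0 ≤ c)
    (hcoset : ∀ q : α × α × α × α, q.1 ≠ q.2.1 → q.2.2.1 ≠ q.2.2.2 → cosetAverage f q ≤ c)
    {u : ι ⊕ ι → α} (hu : u.Injective) {B : Finset (Perm α)}
    (hB : (#B : ℝ) ≤ (Fintype.card α).factorial / (Fintype.card α : ℝ) ^ 2) :
    ∑ z ∈ conjPairs (anchored u) B, f (z.1 * z.2 * z.1⁻¹) ≤
      #(anchored u) * ((Fintype.card α).factorial / (Fintype.card α : ℝ) ^ 2) *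
        ((16 * Fintype.card ι + 8) * K + Fintype.card ι ^ 2 / 2 *
          (4 * (Fintype.card ι).factorial * (16 * c + 1728 * K / Fintype.card α) +
            128 * #(largeCosets f c) * (16 * K + 1728 * K / Fintype.card α) /
              Fintype.card α)) := by
  set N := Fintype.card α
  set k := Fintype.card ι
  set T : ℝ := N.factorial / (N : ℝ) ^ 2
  have hN : (0 : ℝ) < N := by exact_mod_cast (by omega : 0 < N)
  have hK₀ : 0 ≤ K := nonneg_of_mul_nonneg_left
    ((sum_nonneg fun σ _ => abs_nonneg (f σ)).trans hK) (by positivity : 0 < T)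
  have hanchored := factorial_le_four_mul_card_anchored hu hια
  have hpow : ((N - 2 * k).factorial * N ^ k : ℕ) ≤ (8 * #(anchored u) : ℝ) := by
    have := (factorial_mul_pow_le (by omega : 4 * k ^ 2 ≤ N)).trans
      (Nat.mul_le_mul_left 2 hanchored)
    exact_mod_cast this.trans_eq (by ring)
  have hpairs : (#(conjPairs (anchored u) B) : ℝ) ≤ k.factorial * (4 * #(anchored u)) * T := by
    have hcard := card_conjPairs_le anchored_subset B (A := anchored u)
    rw [card_image_of_injective _ (hu.comp Sum.inl_injective), card_univ] at hcard
    calc _ ≤ ((k.factorial * (4 * #(anchored u)) * #B : ℕ) : ℝ) := by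
          exact_mod_cast hcard.trans (Nat.mul_le_mul_right _ (Nat.mul_le_mul_left _ hanchored))
      _ ≤ _ := by
          push_cast
          gcongr
  calc _ ≤ (2 * k + 1) * (((N - 2 * k).factorial * N ^ k : ℕ) * ∑ σ, |f σ|) +
        k ^ 2 / 2 * (#(conjPairs (anchored u) B) * (16 * c + 1728 * K / N) +
          #(anchored u) * (16 * (#(largeCosets f c) * (N - 3).factorial) *
            (16 * K + 1728 * K / N))) :=
        hf.sum_conj_anchored_le hα hc
          (hK.trans (mul_le_mul_of_nonneg_left (factorial_div_sq_le (by omega)) hK₀)) hcoset hu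
          (filter_subset _ _)
    _ ≤ (2 * k + 1) * (8 * #(anchored u) * (K * T)) +
        k ^ 2 / 2 * (k.factorial * (4 * #(anchored u)) * T * (16 * c + 1728 * K / N) +
          #(anchored u) * (16 * (#(largeCosets f c) * (8 * T / N)) *
            (16 * K + 1728 * K / N))) := by
        have := factorial_sub_three_le (by omega : 3 ≤ N)
        gcongr
    _ = _ := by ring

lemma IsQuadratic.mul_sub_two_div_two_le (hf : IsQuadratic f) (hform : HasConjForm f x₀ x₁ x₂ x₃)
    (h₀ : ∑ σ, f σ = 0) (h₁ : f 1 = 1) {k : ℕ} (hk : 2 ≤ k)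
    (hkα : 12 * k ^ 2 + 2 * k + 50 ≤ Fintype.card α) {K : ℝ} (hKα : 90 * K ≤ Fintype.card α)
    (hK : ∑ σ, |f σ| ≤ K * ((Fintype.card α).factorial / (Fintype.card α : ℝ) ^ 2))
    {a : ℝ} (ha : 0 ≤ a) (hB : (#{σ | a / (Fintype.card α : ℝ) ^ 2 ≤ f σ} : ℝ) ≤
      (Fintype.card α).factorial / (Fintype.card α : ℝ) ^ 2) {c : ℝ} (hc : 0 ≤ c)
    (hcoset : ∀ q : α × α × α × α, q.1 ≠ q.2.1 → q.2.2.1 ≠ q.2.2.2 → cosetAverage f q ≤ c) :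
    (k * (k - 2) / 2 : ℝ) ≤ a + (64 + 49 * k) * K +
      k ^ 2 / 2 * (4 * k.factorial * (16 * c + 1728 * K / Fintype.card α) +
        128 * #(largeCosets f c) * (16 * K + 1728 * K / Fintype.card α) / Fintype.card α) := by
  obtain ⟨u⟩ : Nonempty (Fin k ⊕ Fin k ↪ α) := Function.Embedding.nonempty_of_card_le (by
    rw [Fintype.card_sum, Fintype.card_fin]
    omega)
  have hια : 12 * Fintype.card (Fin k) ^ 2 + Fintype.card (Fin k) + 2 ≤ Fintype.card α := by
    rw [Fintype.card_fin]
    omega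
  have hupper := hf.sum_conjPairs_anchored_le (by omega) hια hK hc hcoset u.injective hB
  have hanchored := factorial_le_four_mul_card_anchored u.injective hια
  rw [Fintype.card_fin] at hanchored hupper
  have hS : #(univ.image (u ∘ Sum.inl)) = k := by
    rw [card_image_of_injective _ (u.injective.comp Sum.inl_injective), card_univ, Fintype.card_fin]
  set N := Fintype.card α
  have hN : (50 : ℝ) ≤ N := by exact_mod_cast (by omega : 50 ≤ N)
  have hsmall : K / (N : ℝ) ^ 2 * (12 + 33 * N) ≤ 1 / 2 := by
    rw [div_mul_eq_mul_div, div_le_iff₀ (by positivity)]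
    nlinarith
  have hlower := hform.card_mul_le_sum_conjPairs h₀ h₁ (hK.trans_eq (by ring)) hsmall
    (by positivity : 0 ≤ a / (N : ℝ) ^ 2) (hk.trans_eq hS.symm) (by omega) anchored_subset
    (by rwa [hS])
  rw [hS] at hlower
  have hA : (0 : ℝ) < #(anchored u) * (N.factorial / (N : ℝ) ^ 2) := by
    have := pos_of_mul_pos_right ((Nat.factorial_pos _).trans_le hanchored) (Nat.zero_le _)
    positivity
  have hscale : #(anchored u) * N.factorial * (k * (k - 2) / (2 * (N : ℝ) ^ 2) -
      (56 + 33 * k) * (K / (N : ℝ) ^ 2) - a / (N : ℝ) ^ 2) =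
      #(anchored u) * (N.factorial / (N : ℝ) ^ 2) *
        (k * (k - 2) / 2 - (56 + 33 * k) * K - a) := by
    field_simp
  rw [hscale] at hlower
  linarith [le_of_mul_le_mul_left (hlower.trans hupper) hA]

lemma IsQuadratic.cosetAverage_le_of_card_lt (hf : IsQuadratic f) (hα : 50 ≤ Fintype.card α)
    {i j k l : α} (hij : i ≠ j) (hkl : k ≠ l) {K : ℝ}
    (hK : ∑ σ, |f σ| ≤ K * ((Fintype.card α).factorial / (Fintype.card α : ℝ) ^ 2)) {a c η : ℝ}
    (hc : 0 < c) (hac : 2 * a ≤ c * Fintype.card α) (hKη : 48 * K ≤ c * η * Fintype.card α)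
    (hB : #{σ | a / (Fintype.card α : ℝ) ^ 2 ≤ f σ} <
      (1 - η) * ((Fintype.card α).factorial / (Fintype.card α : ℝ) ^ 2)) :
    cosetAverage f (i, j, k, l) ≤ c := by
  by_contra! hlt
  set N := Fintype.card α
  set T : ℝ := N.factorial / (N : ℝ) ^ 2
  have hN : (1 : ℝ) ≤ N := by exact_mod_cast (by omega : 1 ≤ N)
  have hthreshold : a / (N : ℝ) ^ 2 ≤ c / 2 := by
    rw [div_le_iff₀ (by positivity)]
    nlinarith [mul_le_mul_of_nonneg_left hN (by positivity : 0 ≤ c * N)]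
  have hmass : 24 * (∑ σ, |f σ|) / (N * (c / 2)) ≤ η * T := by
    rw [div_le_iff₀ (by positivity)]
    nlinarith [mul_le_mul_of_nonneg_right hKη (by positivity : 0 ≤ T)]
  have hcard := hf.sub_le_card_of_le_cosetAverage hα hij hkl (half_pos hc)
    (by linarith : c / 2 + a / (N : ℝ) ^ 2 ≤ _)
  linarith [factorial_div_sq_le (by omega : 2 ≤ N)]

lemma four_mul_mul_add_le_half {A b L m N : ℝ} (hA : 1 ≤ A) (hb : 1 ≤ b) (hL : L ≤ m)
    (hm : 8192 * A * b ≤ m) (hN : 17408 * A * m ≤ N) :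
    4 * b * (16 * (1 / (512 * b)) + 1728 * (2 * A) / N) +
      128 * L * (16 * (2 * A) + 1728 * (2 * A) / N) / N ≤ 1 / 2 := by
  have hm₀ : 8192 ≤ m := by nlinarith
  have hmA : m ≤ A * m := le_mul_of_one_le_left (by linarith) hA
  have hN₀ : 0 < N := by linarith
  have hfirst : 4 * b * (1728 * (2 * A) / N) ≤ 1 / 8 := by
    rw [← mul_div_assoc, div_le_iff₀ hN₀]
    linarith
  have hratio : 1728 * (2 * A) / N ≤ 2 * A := by
    rw [div_le_iff₀ hN₀]
    nlinarith
  have hsecond : 128 * L * (16 * (2 * A) + 1728 * (2 * A) / N) / N ≤ 1 / 4 := by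
    calc _ ≤ 128 * m * (16 * (2 * A) + 2 * A) / N := by gcongr
      _ ≤ 1 / 4 := by
        rw [div_le_iff₀ hN₀]
        linarith
  have hsplit : 4 * b * (16 * (1 / (512 * b)) + 1728 * (2 * A) / N) =
      1 / 8 + 4 * b * (1728 * (2 * A) / N) := by
    field_simp
    ring
  linarith

lemma sum_abs_le_two_mul_add_one_mul (h₀ : ∑ σ, f σ = 0) (hle : ∀ σ, f σ ≤ 1) {a : ℝ}
    (ha : 0 ≤ a) (hB : #{σ | a / (Fintype.card α : ℝ) ^ 2 ≤ f σ} ≤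
      (Fintype.card α).factorial / (Fintype.card α : ℝ) ^ 2) :
    ∑ σ, |f σ| ≤ 2 * (a + 1) * ((Fintype.card α).factorial / (Fintype.card α : ℝ) ^ 2) := by
  refine (sum_abs_le_of_le_one h₀ hle (s := a / (Fintype.card α : ℝ) ^ 2) (by positivity)).trans ?_
  rw [Fintype.card_perm, div_mul_eq_mul_div, mul_div_assoc]
  linarith

theorem IsQuadratic.one_sub_mul_le_card (hf : IsQuadratic f) (hform : HasConjForm f x₀ x₁ x₂ x₃)
    (h₀ : ∑ σ, f σ = 0) (hle : ∀ σ, f σ ≤ 1) (h₁ : f 1 = 1) {a η : ℝ} (ha : 0 ≤ a) (hη : 0 < η)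
    (hη₁ : η ≤ 1) {k m : ℕ} (hk : 500 * (a + 1) ≤ k)
    (hkα : 12 * k ^ 2 + 2 * k + 50 ≤ Fintype.card α) (hm : 8192 * (a + 1) * k.factorial < m)
    (hmα : 17408 * (a + 1) * m ≤ η * Fintype.card α) :
    (1 - η) * ((Fintype.card α).factorial / (Fintype.card α : ℝ) ^ 2) ≤
      #{σ | a / (Fintype.card α : ℝ) ^ 2 ≤ f σ} := by
  by_contra! hB
  set N := Fintype.card α
  set T : ℝ := N.factorial / (N : ℝ) ^ 2
  set c : ℝ := 1 / (512 * k.factorial)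
  have hN : (50 : ℝ) ≤ N := by exact_mod_cast (by omega : 50 ≤ N)
  have hfact : (1 : ℝ) ≤ k.factorial := by exact_mod_cast k.factorial_pos
  have hT : 0 < T := by positivity
  have hc : 0 < c := by positivity
  have hm₀ : (8192 : ℝ) ≤ m := by nlinarith
  have hmA : (m : ℝ) ≤ (a + 1) * m := le_mul_of_one_le_left (by positivity) (by linarith)
  have hηN : η * N ≤ N := mul_le_of_le_one_left (by linarith) hη₁
  have hBT : (#{σ | a / (N : ℝ) ^ 2 ≤ f σ} : ℝ) ≤ T := by nlinarith
  have hK := sum_abs_le_two_mul_add_one_mul h₀ hle ha hBT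
  have hscale (x y : ℝ) (h : x * (512 * k.factorial) ≤ y) : x ≤ c * y := by
    rwa [one_div_mul_eq_div, le_div_iff₀ (by positivity)]
  have hcoset (q : α × α × α × α) (hij : q.1 ≠ q.2.1) (hkl : q.2.2.1 ≠ q.2.2.2) :
      cosetAverage f q ≤ c :=
    hf.cosetAverage_le_of_card_lt (by omega) hij hkl hK hc (hscale _ _ (by nlinarith))
      (by rw [mul_assoc]; exact hscale _ _ (by linarith)) hB
  have hlarge : #(largeCosets f c) < m := by
    refine hf.card_largeCosets_lt (by omega) hc
      (hK.trans (mul_le_mul_of_nonneg_left (factorial_div_sq_le (by omega)) (by positivity)))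
      ?_ (hscale _ _ (by linarith)) ?_
    · rw [one_div_mul_eq_div, lt_div_iff₀ (by positivity)]
      linarith
    · have : (4 * m + 2 : ℝ) ≤ N := by linarith
      exact_mod_cast this
  have hkA : k ≤ (a + 1) * k := le_mul_of_one_le_left (by positivity) (by linarith)
  have hmain := hf.mul_sub_two_div_two_le hform h₀ h₁ (k := k)
    (by exact_mod_cast (by linarith : (2 : ℝ) ≤ k)) hkα (by nlinarith) hK ha hBT hc.le hcoset
  have hhalf := four_mul_mul_add_le_half (by linarith : 1 ≤ a + 1) hfact
    (by exact_mod_cast hlarge.le : (#(largeCosets f c) : ℝ) ≤ m) hm.le (hmα.trans hηN)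
  nlinarith [mul_le_mul_of_nonneg_left hhalf (by positivity : (0 : ℝ) ≤ k ^ 2 / 2)]

theorem exists_mul_factorial_div_sq_le_card {a p : ℝ} (ha : 0 ≤ a) (hp₀ : 0 ≤ p) (hp : p < 1) :
    ∃ N : ℕ, ∀ n : ℕ, N ≤ n → ∀ C : Fin n → Fin n → Fin n → Fin n → ℝ,
      ∑ σ, qapObjective C σ = 0 → (∀ σ, qapObjective C σ ≤ 1) → qapObjective C 1 = 1 →
      p * (n.factorial / (n : ℝ) ^ 2) ≤
        #{σ | a / (n : ℝ) ^ 2 ≤ qapObjective C σ} := by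
  obtain ⟨k, hk⟩ := exists_nat_ge (500 * (a + 1))
  obtain ⟨m, hm⟩ := exists_nat_gt (8192 * (a + 1) * k.factorial)
  obtain ⟨N, hN⟩ := exists_nat_ge (17408 * (a + 1) * m / (1 - p))
  refine ⟨max N (12 * k ^ 2 + 2 * k + 50), fun n hn C h₀ hle h₁ => ?_⟩
  obtain ⟨x₀, x₁, x₂, x₃, hform⟩ := exists_conjAverage_form C
  have hNn : (N : ℝ) ≤ n := by exact_mod_cast le_of_max_le_left hn
  have hmη : 17408 * (a + 1) * m ≤ (1 - p) * n := by
    rw [mul_comm (1 - p)]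
    exact (div_le_iff₀ (sub_pos.2 hp)).1 (hN.trans hNn)
  have hcard := (isQuadratic_qapObjective C).one_sub_mul_le_card hform h₀ hle h₁ ha
    (sub_pos.2 hp) (sub_le_self 1 hp₀) hk (m := m)
  simp only [Fintype.card_fin, sub_sub_cancel] at hcard
  exact hcard (le_of_max_le_right hn) hm hmη

end Sharp

/-! ### Values further away from the average -/

section FarValues

lemma HasConjForm.div_mul_factorial_le_card {α : Type*} [Fintype α] [DecidableEq α]
    {f : Perm α → ℝ} {x₀ x₁ x₂ x₃ : ℝ} (hf : HasConjForm f x₀ x₁ x₂ x₃) (h₀ : ∑ σ, f σ = 0)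
    (hle : ∀ σ, f σ ≤ 1) (h₁ : f 1 = 1) {b : ℝ} (hb : 1 ≤ b) {k : ℕ} (hk : 1000 * b ≤ k)
    (hkα : k + 3 ≤ Fintype.card α) :
    b / (Fintype.card α : ℝ) ^ 2 / (3 * k.factorial) * (Fintype.card α).factorial ≤
      #{σ | b / (Fintype.card α : ℝ) ^ 2 ≤ f σ} := by
  set N := Fintype.card α
  have hN : (k + 3 : ℝ) ≤ N := by exact_mod_cast hkα
  have hN₀ : (0 : ℝ) < N := by linarith
  have hfact : (1 : ℝ) ≤ k.factorial := by exact_mod_cast k.factorial_pos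
  obtain hB | hB := le_total (#{σ | b / (N : ℝ) ^ 2 ≤ f σ} : ℝ) (b / (N : ℝ) ^ 2 * N.factorial)
  · have hsmall : 4 * (b / (N : ℝ) ^ 2) * (12 + 33 * N) ≤ 1 / 2 := by
      rw [← mul_div_assoc, div_mul_eq_mul_div, div_le_iff₀ (by positivity)]
      nlinarith
    have hcard := hf.le_card_mul h₀ h₁ hle (by positivity : 0 ≤ b / (N : ℝ) ^ 2) hsmall hB
      (by exact_mod_cast (by linarith : (2 : ℝ) ≤ k)) hkα
    change (_ / (2 * (N : ℝ) ^ 2) - _) * (N.factorial : ℝ) ≤ _ at hcard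
    rw [div_mul_eq_mul_div, div_le_iff₀ (by positivity), mul_comm _ (3 * _ : ℝ)]
    refine le_trans ?_ hcard
    have hquad : b ≤ k * (k - 2) / 2 - (225 + 132 * k) * b := by nlinarith
    calc b / (N : ℝ) ^ 2 * N.factorial ≤
          (k * (k - 2) / 2 - (225 + 132 * k) * b) / (N : ℝ) ^ 2 * N.factorial := by gcongr
      _ = _ := by
        field_simp
  · refine (mul_le_mul_of_nonneg_right ?_ (by positivity)).trans hB
    exact div_le_self (by positivity) (by linarith)

lemma exp_neg_rpow_le {x ε δ : ℝ} (hε₁ : ε ≤ 1) (hlog : 1 ≤ Real.log x)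
    (hx : 1005 * Real.log x ≤ x ^ (δ - (1 - ε))) {k : ℕ} (hk : k ≤ 1001 * x ^ (1 - ε))
    (hkx : k ≤ x) : Real.exp (-x ^ δ) ≤ x ^ (-1 - ε) / (3 * k.factorial) := by
  have hx₁ : 1 < x := by
    by_contra! hle
    linarith [Real.log_nonpos (k.cast_nonneg.trans hkx) hle]
  have hx₀ : 0 < x := by linarith
  have hpow : 1 ≤ x ^ (1 - ε) := Real.one_le_rpow hx₁.le (by linarith)
  have hexponent : 2 + k * Real.log x + (1 + ε) * Real.log x ≤ x ^ δ := by
    have hδ : x ^ δ = x ^ (1 - ε) * x ^ (δ - (1 - ε)) := by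
      rw [← Real.rpow_add hx₀]
      congr 1
      ring
    have := mul_le_mul_of_nonneg_left hx (by positivity : 0 ≤ x ^ (1 - ε))
    nlinarith
  have hthree : 3 ≤ Real.exp 2 := by linarith [Real.add_one_le_exp 2]
  have hfact : (k.factorial : ℝ) ≤ Real.exp (k * Real.log x) := by
    calc (k.factorial : ℝ) ≤ (k : ℝ) ^ k := by exact_mod_cast k.factorial_le_pow
      _ ≤ x ^ k := by gcongr
      _ = _ := by rw [mul_comm, ← Real.rpow_def_of_pos hx₀, Real.rpow_natCast]
  rw [le_div_iff₀ (by positivity), Real.rpow_def_of_pos hx₀ (-1 - ε)]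
  calc Real.exp (-x ^ δ) * (3 * k.factorial) ≤
        Real.exp (-x ^ δ) * (Real.exp 2 * Real.exp (k * Real.log x)) := by gcongr
    _ = Real.exp (-x ^ δ + (2 + k * Real.log x)) := by rw [Real.exp_add, Real.exp_add]
    _ ≤ _ := Real.exp_le_exp.2 (by linarith)

lemma eventually_le_rpow_and_log_le_rpow {ε γ : ℝ} (hε : 0 < ε) (hγ : 0 < γ) :
    ∀ᶠ n : ℕ in Filter.atTop, 1 ≤ Real.log n ∧ 1004 ≤ (n : ℝ) ^ ε ∧
      1005 * Real.log n ≤ (n : ℝ) ^ γ := by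
  refine tendsto_natCast_atTop_atTop.eventually (p := fun x : ℝ => 1 ≤ Real.log x ∧
    1004 ≤ x ^ ε ∧ 1005 * Real.log x ≤ x ^ γ) ?_
  filter_upwards [Real.tendsto_log_atTop.eventually_ge_atTop 1,
    (tendsto_rpow_atTop hε).eventually_ge_atTop 1004, Filter.eventually_ge_atTop 0,
    (isLittleO_log_rpow_atTop hγ).bound (by norm_num : (0 : ℝ) < 1 / 1005)] with x hlog hpow hx hO
  rw [Real.norm_of_nonneg (by linarith), Real.norm_of_nonneg (by positivity)] at hO
  exact ⟨hlog, hpow, by linarith⟩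

theorem exists_exp_mul_factorial_le_card {ε δ : ℝ} (hε : 0 < ε) (hε₁ : ε ≤ 1) (hδ : 1 - ε < δ) :
    ∃ N : ℕ, ∀ n : ℕ, N ≤ n → ∀ C : Fin n → Fin n → Fin n → Fin n → ℝ,
      ∑ σ, qapObjective C σ = 0 → (∀ σ, qapObjective C σ ≤ 1) → qapObjective C 1 = 1 →
      Real.exp (-(n : ℝ) ^ δ) * n.factorial ≤
        #{σ | (n : ℝ) ^ (-1 - ε) ≤ qapObjective C σ} := by
  obtain ⟨N, hN⟩ := Filter.eventually_atTop.1
    (eventually_le_rpow_and_log_le_rpow hε (sub_pos.2 hδ))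
  refine ⟨max N 1, fun n hn C h₀ hle h₁ => ?_⟩
  obtain ⟨hlog, hpow, hlogpow⟩ := hN n (le_of_max_le_left hn)
  obtain ⟨x₀, x₁, x₂, x₃, hform⟩ := exists_conjAverage_form C
  have hn₁ : (1 : ℝ) ≤ n := by exact_mod_cast le_of_max_le_right hn
  have hn₀ : (0 : ℝ) < n := by linarith
  set b : ℝ := (n : ℝ) ^ (1 - ε)
  have hb : 1 ≤ b := Real.one_le_rpow hn₁ (by linarith)
  have hthreshold : (n : ℝ) ^ (-1 - ε) = b / (n : ℝ) ^ 2 := by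
    rw [← Real.rpow_natCast, ← Real.rpow_sub hn₀]
    congr 1
    push_cast
    ring
  have hbn : 1004 * b ≤ n := by
    calc 1004 * b ≤ (n : ℝ) ^ ε * b := by gcongr
      _ = n := by rw [← Real.rpow_add hn₀, add_sub_cancel, Real.rpow_one]
  set k := ⌈1000 * b⌉₊
  have hk : 1000 * b ≤ k := Nat.le_ceil _
  have hkb : k ≤ 1001 * b := by linarith [Nat.ceil_lt_add_one (by positivity : 0 ≤ 1000 * b)]
  have hkn : (k + 3 : ℝ) ≤ n := by linarith
  have hform : HasConjForm (qapObjective C) x₀ x₁ x₂ x₃ := hform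
  have hcard := hform.div_mul_factorial_le_card h₀ hle h₁ hb hk
    (by rw [Fintype.card_fin]; exact_mod_cast hkn)
  rw [Fintype.card_fin, ← hthreshold] at hcard
  refine le_trans ?_ hcard
  gcongr
  exact exp_neg_rpow_le hε₁ hlog hlogpow hkb (by linarith)

end FarValues

section Normalization

variable {n : ℕ}

lemma sum_permShift (f : Perm (Fin n) → ℝ) : ∑ σ, permShift f σ = 0 := by
  simp only [permShift, permAverage, sum_sub_distrib, sum_const, card_univ, Fintype.card_perm,
    Fintype.card_fin, nsmul_eq_mul]
  rw [mul_div_cancel₀ _ (by positivity), sub_self]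

lemma permProb_ofPred (p : Perm (Fin n) → Prop) [DecidablePred p] :
    permProb {σ | p σ} = #{σ | p σ} / n.factorial := by
  rw [permProb, ← Set.ncard_coe_finset, coe_filter_univ]

lemma exists_qapObjective_eq_permShift_mul_div (hn : n ≠ 0)
    (C : Fin n → Fin n → Fin n → Fin n → ℝ) (τ : Perm (Fin n)) (M : ℝ) :
    ∃ C', ∀ σ, qapObjective C' σ = permShift (qapObjective C) (τ * σ) / M := by
  refine ⟨fun i j k l => (C i j (τ k) (τ l) - permAverage (qapObjective C) / (n : ℝ) ^ 2) / M,
    fun σ => ?_⟩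
  simp only [qapObjective, ← sum_div, sum_sub_distrib, sum_const, card_univ, Fintype.card_fin,
    nsmul_eq_mul, permShift, Perm.mul_apply]
  congr 2
  field_simp

lemma le_permProb_of_normalized (hn : n ≠ 0) {s p : ℝ} (hp : p ≤ 1)
    (h : ∀ C : Fin n → Fin n → Fin n → Fin n → ℝ, ∑ σ, qapObjective C σ = 0 →
      (∀ σ, qapObjective C σ ≤ 1) → qapObjective C 1 = 1 →
      p * n.factorial ≤ #{σ | s ≤ qapObjective C σ})
    (C : Fin n → Fin n → Fin n → Fin n → ℝ) (τ : Perm (Fin n))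
    (hτ : ∀ σ, permShift (qapObjective C) σ ≤ permShift (qapObjective C) τ) :
    p ≤ permProb {σ | s * permShift (qapObjective C) τ ≤ permShift (qapObjective C) σ} := by
  have hsum := sum_permShift (qapObjective C)
  set f := permShift (qapObjective C)
  rw [permProb_ofPred, le_div_iff₀ (by positivity)]
  obtain hneg | hzero | hpos := lt_trichotomy (f τ) 0
  · exact absurd hsum
      (sum_neg (fun σ _ => (hτ σ).trans_lt hneg) univ_nonempty).ne
  · have hf (σ) : f σ = 0 :=
      (sum_eq_zero_iff_of_nonpos fun σ _ => (hτ σ).trans_eq hzero).1 hsum σ (mem_univ σ)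
    simp only [hf, mul_zero, le_refl, filter_true, card_univ, Fintype.card_perm, Fintype.card_fin]
    exact mul_le_of_le_one_left (by positivity) hp
  · obtain ⟨C', hC'⟩ := exists_qapObjective_eq_permShift_mul_div hn C τ (f τ)
    have hsum' : ∑ σ, qapObjective C' σ = 0 := by
      simp only [hC', ← sum_div]
      exact div_eq_zero_iff.2 (.inl ((Equiv.sum_comp (Equiv.mulLeft τ) f).trans hsum))
    refine (h C' hsum' (fun σ => ?_) ?_).trans_eq ?_
    · rw [hC', div_le_one hpos]
      exact hτ _
    · rw [hC', mul_one, div_self hpos.ne']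
    · refine congrArg _ (card_equiv (Equiv.mulLeft τ) fun σ => ?_)
      simp only [mem_filter, mem_univ, true_and, hC', le_div_iff₀ hpos, Equiv.coe_mulLeft]
      rfl

end Normalization

end QAP

theorem corollary5p2_general :
    (∀ α p : ℝ, 0 ≤ α → 0 ≤ p → p < 1 → ∃ N : ℕ, ∀ n : ℕ, N ≤ n →
      ∀ (C : Fin n → Fin n → Fin n → Fin n → ℝ) (τ : Equiv.Perm (Fin n)),
        (∀ σ, permShift (qapObjective C) σ ≤ permShift (qapObjective C) τ) →
        p * ((n : ℝ) ^ 2)⁻¹ ≤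
          permProb {σ | α / (n : ℝ) ^ 2 * permShift (qapObjective C) τ ≤
            permShift (qapObjective C) σ}) ∧
    (∀ ε : ℝ, 0 < ε → ∀ δ : ℝ, 0 < δ → 1 - ε < δ → ∃ N : ℕ, ∀ n : ℕ, N ≤ n →
      ∀ (C : Fin n → Fin n → Fin n → Fin n → ℝ) (τ : Equiv.Perm (Fin n)),
        (∀ σ, permShift (qapObjective C) σ ≤ permShift (qapObjective C) τ) →
        Real.exp (-(n : ℝ) ^ δ) ≤
          permProb {σ | (n : ℝ) ^ (-1 - ε) * permShift (qapObjective C) τ ≤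
            permShift (qapObjective C) σ}) := by
  refine ⟨fun α p hα hp₀ hp => ?_, fun ε hε δ hδ hεδ => ?_⟩
  · obtain ⟨N, hN⟩ := QAP.exists_mul_factorial_div_sq_le_card hα hp₀ hp
    refine ⟨max N 1, fun n hn C τ hτ => ?_⟩
    have hn₁ : 1 ≤ n := le_of_max_le_right hn
    have hn₁' : (1 : ℝ) ≤ n := by exact_mod_cast hn₁
    refine QAP.le_permProb_of_normalized (by omega)
      (mul_le_one₀ hp.le (by positivity) (inv_le_one_of_one_le₀ (one_le_pow₀ hn₁')))
      (fun C' h₀ hle h₁ => ?_) C τ hτ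
    exact (hN n (le_of_max_le_left hn) C' h₀ hle h₁).trans_eq' (by ring)
  · obtain ⟨N, hN⟩ := QAP.exists_exp_mul_factorial_le_card (lt_min hε one_pos) (min_le_right ε 1)
      (sub_lt_comm.1 (lt_min (sub_lt_comm.1 hεδ) (sub_lt_self 1 hδ)))
    refine ⟨max N 1, fun n hn C τ hτ => ?_⟩
    have hn₁ : 1 ≤ n := le_of_max_le_right hn
    have hn₁' : (1 : ℝ) ≤ n := by exact_mod_cast hn₁
    refine QAP.le_permProb_of_normalized (by omega)
      (Real.exp_le_one_iff.2 (neg_nonpos.2 (by positivity))) (fun C' h₀ hle h₁ => ?_) C τ hτ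
    refine (hN n (le_of_max_le_left hn) C' h₀ hle h₁).trans ?_
    have hthreshold : (n : ℝ) ^ (-1 - ε) ≤ (n : ℝ) ^ (-1 - min ε 1) :=
      Real.rpow_le_rpow_of_exponent_le hn₁' (sub_le_sub_left (min_le_left ε 1) _)
    gcongr with σ

theorem corollary5p2 :
    (∃ c : ℝ, 0 < c ∧ ∀ α : ℝ, 1 < α → ∃ N : ℕ, ∀ n : ℕ, N ≤ n →
      ∀ (C : Fin n → Fin n → Fin n → Fin n → ℝ) (τ : Equiv.Perm (Fin n)),
        (∀ σ, permShift (qapObjective C) σ ≤ permShift (qapObjective C) τ) →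
        Real.exp (-(c * α * Real.log α)) * ((n : ℝ) ^ 2)⁻¹ ≤
          permProb {σ | α / (n : ℝ) ^ 2 * permShift (qapObjective C) τ ≤
            permShift (qapObjective C) σ}) ∧
    (∀ ε : ℝ, 0 < ε → ∀ δ : ℝ, 0 < δ → 1 - ε < δ → ∃ N : ℕ, ∀ n : ℕ, N ≤ n →
      ∀ (C : Fin n → Fin n → Fin n → Fin n → ℝ) (τ : Equiv.Perm (Fin n)),
        (∀ σ, permShift (qapObjective C) σ ≤ permShift (qapObjective C) τ) →
        Real.exp (-(n : ℝ) ^ δ) ≤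
          permProb {σ | (n : ℝ) ^ (-1 - ε) * permShift (qapObjective C) τ ≤
            permShift (qapObjective C) σ}) := by
  obtain ⟨hsharp, hfar⟩ := corollary5p2_general
  exact ⟨⟨1, one_pos, fun α hα => hsharp α _ (by linarith) (Real.exp_pos _).le
    (Real.exp_lt_one_iff.2 (neg_neg_of_pos (by have := Real.log_pos hα; positivity)))⟩, hfar⟩
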